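/- **Proposition (action of $\phi^*$ on $H^2(\widehat{Q},(\mathbb{Z}/t\mathbb{Z})^2)$).** Let $B$ be a closed orientable hyperbolic $2$-orbifold whose underlying surface has genus $g\ge 0$ and whose singular locus consists of $r\ge 0$ cone points of orders $m_1,\dots,m_r\ge 2$ (so $2-2g-\sum_{i=1}^r(1-1/m_i)<0$), and let $$Q=\pi_1^{\mathrm{orb}}(B)=\Big\langle x_1,\dots,x_r,u_1,v_1,\dots,u_g,v_g\ \Big|\ x_i^{m_i}=1\ (1\le i\le r),\ \ x_1\cdots x_r\prod_{j=1}^{g}[u_j,v_j]=1\Big\rangle .$$ Let $\widehat{Q}$ be the profinite completion of $Q$, and denote the image of $x_i$ in $\widehat{Q}$ again by $x_i$. Let $\phi$ be a (continuous) automorphism of $\widehat{Q}$ and let $k_1,\dots,k_r$ be integers such that, for every $i$, $\phi(x_i)$ is conjugate in $\widehat{Q}$ to $x_i^{k_i}$. Then there is a profinite integer $\kappa\in\widehat{\mathbb{Z}}$ with $$\kappa\equiv k_i \pmod{m_i}\qquad\text{for all } 1\le i\le r,$$ such that for every integer $t\ge 1$ the map $\phi^*$ induced by $\phi$ on the continuous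 cohomology group $H^2(\widehat{Q},(\mathbb{Z}/t\mathbb{Z})^2)$, where $\widehat{Q}$ acts trivially on the discrete group $(\mathbb{Z}/t\mathbb{Z})^2$, is multiplication by $\kappa$ (that is, by $\kappa \bmod t$). -/

import Mathlib

/-- Data of a closed orientable 2-orbifold without reflectors: the genus of the underlying
surface and the orders `m_1, …, m_r ≥ 2` of its cone points. -/
structure OrbifoldSignature where
  genus : ℕ
  numCone : ℕ
  order : Fin numCone → ℕ+
  two_le_order : ∀ i, 2 ≤ (order i : ℕ)

namespace OrbifoldSignature

/-- The orbifold Euler characteristic `2 - 2g - ∑ (1 - 1/m_i)`. -/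
def eulerChar (B : OrbifoldSignature) : ℚ :=
  2 - 2 * (B.genus : ℚ) - ∑ i, (1 - 1 / ((B.order i : ℕ) : ℚ))

/-- A closed 2-orbifold is hyperbolic iff its orbifold Euler characteristic is negative. -/
def IsHyperbolic (B : OrbifoldSignature) : Prop := B.eulerChar < 0

/-- The generators `x_1, …, x_r, u_1, v_1, …, u_g, v_g`. -/
inductive Gen (B : OrbifoldSignature) : Type
  | x (i : Fin B.numCone)
  | u (j : Fin B.genus)
  | v (j : Fin B.genus)

/-- The long relator `x_1 ⋯ x_r [u_1, v_1] ⋯ [u_g, v_g]`. -/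
def longRelator (B : OrbifoldSignature) : FreeGroup B.Gen :=
  (List.ofFn fun i => (FreeGroup.of (Gen.x i) : FreeGroup B.Gen)).prod *
    (List.ofFn fun j => (FreeGroup.of (Gen.u j) * FreeGroup.of (Gen.v j) *
      (FreeGroup.of (Gen.u j))⁻¹ * (FreeGroup.of (Gen.v j))⁻¹ : FreeGroup B.Gen)).prod

/-- The relators `x_i ^ m_i` together with the long relator. -/
def relators (B : OrbifoldSignature) : Set (FreeGroup B.Gen) :=
  Set.range (fun i => FreeGroup.of (Gen.x i) ^ (B.order i : ℕ)) ∪ {B.longRelator}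

/-- The orbifold fundamental group
`⟨x_1, …, x_r, u_1, …, v_g | x_i ^ m_i = 1, x_1 ⋯ x_r [u_1, v_1] ⋯ [u_g, v_g] = 1⟩`. -/
abbrev FundamentalGroup (B : OrbifoldSignature) : Type := PresentedGroup B.relators

/-- The profinite completion of the orbifold fundamental group. -/
abbrev ProfiniteGroup (B : OrbifoldSignature) : ProfiniteGrp.{0} :=
  ProfiniteGrp.ProfiniteCompletion.completion (GrpCat.of B.FundamentalGroup)

/-- The image in the profinite completion of the cone point generator `x_i`. -/
def coneGen (B : OrbifoldSignature) (i : Fin B.numCone) : B.ProfiniteGroup :=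
  ProfiniteGrp.ProfiniteCompletion.etaFn (GrpCat.of B.FundamentalGroup)
    (PresentedGroup.of (Gen.x i))

end OrbifoldSignature

/-- The ring of profinite integers: compatible families of residues modulo all `n ≥ 1`. -/
def ProfiniteInt : Subring (∀ n : ℕ+, ZMod (n : ℕ)) where
  carrier := {a | ∀ (m n : ℕ+) (h : (m : ℕ) ∣ (n : ℕ)), ZMod.castHom h (ZMod (m : ℕ)) (a n) = a m}
  mul_mem' ha hb m n h := by rw [Pi.mul_apply, map_mul, ha m n h, hb m n h, Pi.mul_apply]
  one_mem' m n h := by rw [Pi.one_apply, map_one, Pi.one_apply]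
  add_mem' ha hb m n h := by rw [Pi.add_apply, map_add, ha m n h, hb m n h, Pi.add_apply]
  zero_mem' m n h := by rw [Pi.zero_apply, map_zero, Pi.zero_apply]
  neg_mem' ha m n h := by rw [Pi.neg_apply, map_neg, ha m n h, Pi.neg_apply]

/-- Reduction of a profinite integer modulo `n`. -/
def ProfiniteInt.toZMod (n : ℕ+) : ProfiniteInt →+* ZMod (n : ℕ) :=
  (Pi.evalRingHom (fun n : ℕ+ => ZMod (n : ℕ)) n).comp ProfiniteInt.subtype

section Cohomology

variable (G : Type) [Group G] [TopologicalSpace G] [IsTopologicalGroup G]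

/-- The discrete module `(ℤ/t)²` with trivial action of `G`. -/
noncomputable def trivialRepSq (t : ℕ+) : TopRep (ZMod (t : ℕ)) G :=
  TopRep.of (ContRepresentation.ofMonoidHom
    (1 : G →* ((Fin 2 → ZMod (t : ℕ)) →L[ZMod (t : ℕ)] (Fin 2 → ZMod (t : ℕ)))))

/-- The continuous cohomology group `H²(G, (ℤ/t)²)`, as a `ℤ/t`-module. -/
noncomputable abbrev H2 (t : ℕ+) : TopModuleCat (ZMod (t : ℕ)) :=
  continuousCohomology 2 (trivialRepSq G t)

variable {G}

/-- The map `φ^*` on `H²(G, (ℤ/t)²)` induced by a continuous endomorphism `φ` of `G`, that is,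
precomposition of cochains with `φ` (and the identity on the coefficients). -/
noncomputable def H2map (φ : G →ₜ* G) (t : ℕ+) : H2 G t →L[ZMod (t : ℕ)] H2 G t :=
  (ContinuousCohomology.map φ
    (X := trivialRepSq G t) (Y := trivialRepSq G t)
    (TopRep.ofHom
      { toContinuousLinearMap := ContinuousLinearMap.id (ZMod (t : ℕ)) (Fin 2 → ZMod (t : ℕ))
        isIntertwining' := fun _ => rfl }) 2).hom

end Cohomology

/-! A 2-cocycle `f` on the completion, with values in a compact, totally disconnected trivial module
`A`, defines a central extension. Lifting the generators turns the relators into elements of `A`: `a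
i` from `x_i ^ m_i` and `b` from the long relator. Changing the lift of `x_i` by `c i` adds `m_i
c_i` to `a i` and `c i` to `b`; the lifts of `u_j`, `v_j` occur only in commutators and do not
matter. By the universal property of the completion, `f` is a coboundary exactly when its invariants
vanish up to such changes (`HasInvariants.mem_B2`, `HasInvariants.of_mem_B2`).

Since `φ x_i` is conjugate to `x_i ^ k_i`, pullback multiplies `a i` by `k i` modulo `m_i`
(`exists_wordInv_comap_pow`), while its effect on `b` is unknown. Over `ℤ/N`, let `f₀` have
invariants `(0, 1)` and `e_i` have invariants `(δ_i, 0)`. Then `φ^* f₀ = l f₀` and `φ^* e_i = μ_i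
e_i` in cohomology, with `μ_i ≡ k_i` modulo `m_i`. As `m_i e_i = -f₀`, the numbers `l` and `μ_i`
agree up to an ambiguity killed by `M = ∏ m_i`; for `N = t M²` this gives `l ≡ μ_i` modulo `t`.
Pushforwards of `f₀` and the `e_i` give every class with coefficients killed by `t`, so `φ^*` is
multiplication by `l`, and the `l` for varying `t` form `κ`.

It remains to realise `f₀` and `e_i` on the completion, which amounts to finding finite central
extensions (`exists_hasInvariants_of_finite`, `HasCentralQuotient`). In positive genus a Heisenberg
group suffices. In genus zero, start from a quotient of `SL₂(𝔽_p)` by its centre containing `g_i` of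
order `m_i` with product one. Hyperbolicity and a dimension count give affine maps `σ_i` of the
space of functions on this group, of order dividing `m_i`, with product one and no common fixed
point. Duality then gives functionals `ψ_i` such that the sum of the `ψ_i`-displacements along the
product is the constant 1. Twisting `σ_i` by `ψ_i` over a finite ring keeps `σ_i ^ m_i = 1` and
makes the product a prescribed central translation (`exists_central_perm`). -/

/-! ### Degree-two continuous cohomology through inhomogeneous cocycles -/

section Bridge

open CategoryTheory

universe u v

section

variable {k : Type u} [Ring k] [TopologicalSpace k]

lemma TopModuleCat.homologyπ_surjective (C : CochainComplex (TopModuleCat.{v} k) ℕ) (i : ℕ) :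
    Function.Surjective (C.homologyπ i) := by
  have : Epi ((forget₂ (TopModuleCat.{v} k) (ModuleCat k)).map (C.homologyπ i)) := inferInstance
  exact (ModuleCat.epi_iff_surjective _).1 this

lemma TopModuleCat.iCycles_injective (C : CochainComplex (TopModuleCat.{v} k) ℕ) (i : ℕ) :
    Function.Injective (C.iCycles i) := by
  have : Mono ((forget₂ (TopModuleCat.{v} k) (ModuleCat k)).map (C.iCycles i)) := inferInstance
  exact (ModuleCat.mono_iff_injective _).1 this

/-- Two cycles that differ by a boundary have the same homology class. -/
lemma TopModuleCat.homologyπ_eq_of_sub_eq_d (C : CochainComplex (TopModuleCat.{v} k) ℕ) (i : ℕ)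
    (x y : C.cycles (i + 1)) (τ : C.X i)
    (h : C.iCycles (i + 1) x - C.iCycles (i + 1) y = C.d i (i + 1) τ) :
    C.homologyπ (i + 1) x = C.homologyπ (i + 1) y := by
  have h1 : x - y = C.toCycles i (i + 1) τ := by
    apply TopModuleCat.iCycles_injective C (i + 1)
    rw [map_sub, h]
    exact (congr($(C.toCycles_i i (i + 1)) τ)).symm
  have h2 := congr($(C.toCycles_comp_homologyπ i (i + 1)) τ)
  rw [← sub_eq_zero, ← map_sub, h1]
  exact h2

end

/-- Continuous inhomogeneous 2-cocycles with values in the trivial module `A`. -/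
def Z2 (G : Type*) [Group G] [TopologicalSpace G] (A : Type*) [AddCommGroup A]
    [TopologicalSpace A] [IsTopologicalAddGroup A] : AddSubgroup (G × G → A) where
  carrier := {f | Continuous f ∧ ∀ g h k, f (g, h) + f (g * h, k) = f (h, k) + f (g, h * k)}
  add_mem' {f f'} hf hf' := ⟨hf.1.add hf'.1, fun g h k => by
    simp only [Pi.add_apply]; rw [add_add_add_comm, hf.2, hf'.2, add_add_add_comm]⟩
  zero_mem' := ⟨continuous_const, fun _ _ _ => rfl⟩
  neg_mem' {f} hf := ⟨hf.1.neg, fun g h k => by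
    simp only [Pi.neg_apply]; rw [← neg_add, hf.2, neg_add]⟩

/-- Continuous inhomogeneous 2-coboundaries with values in the trivial module `A`. -/
def B2 (G : Type*) [Group G] [TopologicalSpace G] (A : Type*) [AddCommGroup A]
    [TopologicalSpace A] [IsTopologicalAddGroup A] : AddSubgroup (G × G → A) where
  carrier := {f | ∃ β : G → A, Continuous β ∧ ∀ g h, f (g, h) = β g + β h - β (g * h)}
  add_mem' := by
    rintro f f' ⟨β, hβ, h⟩ ⟨β', hβ', h'⟩
    exact ⟨β + β', hβ.add hβ', fun x y => by simp only [Pi.add_apply, h, h']; abel⟩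
  zero_mem' := ⟨0, continuous_const, fun _ _ => by simp⟩
  neg_mem' := by
    rintro f ⟨β, hβ, h⟩
    exact ⟨-β, hβ.neg, fun x y => by simp only [Pi.neg_apply, h]; abel⟩

variable {G : Type} [Group G] [TopologicalSpace G] [IsTopologicalGroup G]

open TopRep ContRepresentation

/-- Homogeneous 2-cochains as functions of three variables. -/
def homEval {t : ℕ+} (σ : (homogeneousCochains (trivialRepSq G t)).X 2) (x y z : G) :
    Fin 2 → ZMod (t : ℕ) :=
  (show C(G, C(G, C(G, Fin 2 → ZMod (t : ℕ)))) from σ.1) x y z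

lemma homEval_invariant {t : ℕ+} (σ : (homogeneousCochains (trivialRepSq G t)).X 2)
    (g x y z : G) : homEval σ (g * x) (g * y) (g * z) = homEval σ x y z := by
  have h1 := σ.2 g⁻¹
  have h2 := congr((show C(G, C(G, C(G, Fin 2 → ZMod (t : ℕ)))) from $h1) x y z)
  refine Eq.trans ?_ h2
  change _ = homEval σ (g⁻¹⁻¹ * x) (g⁻¹⁻¹ * y) (g⁻¹⁻¹ * z)
  rw [inv_inv]

lemma homEval_d {t : ℕ+} (τ : (homogeneousCochains (trivialRepSq G t)).X 1) (x y z : G) :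
    homEval ((homogeneousCochains (trivialRepSq G t)).d 1 2 τ) x y z =
     (show C(G, C(G, Fin 2 → ZMod (t : ℕ))) from τ.1) y z -
     (show C(G, C(G, Fin 2 → ZMod (t : ℕ))) from τ.1) x z +
     (show C(G, C(G, Fin 2 → ZMod (t : ℕ))) from τ.1) x y := by
  have h1 := homogeneousCochains.d_apply (trivialRepSq G t) 1 τ
  have h2 := congr((show C(G, C(G, C(G, Fin 2 → ZMod (t : ℕ)))) from $h1) x y z)
  refine Eq.trans h2 ?_
  rw [sub_add]
  rfl

lemma homEval_cocycle {t : ℕ+} (σ : (homogeneousCochains (trivialRepSq G t)).X 2)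
    (hσ : (homogeneousCochains (trivialRepSq G t)).d 2 3 σ = 0) (x y z w : G) :
    homEval σ y z w - homEval σ x z w + homEval σ x y w - homEval σ x y z = 0 := by
  have h1 := homogeneousCochains.d_apply (trivialRepSq G t) 2 σ
  have h0 : ((homogeneousCochains (trivialRepSq G t)).d 2 3 σ).1 = 0 := by rw [hσ]; rfl
  have h2 := congr((show C(G, C(G, C(G, C(G, Fin 2 → ZMod (t : ℕ))))) from
    $(h0.symm.trans h1)) x y z w)
  refine Eq.trans ?_ h2.symm
  have h3 : ∀ a b c d : Fin 2 → ZMod (t : ℕ), a - b + c - d = a - (b - (c - d)) := fun _ _ _ _ => by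
    abel
  exact h3 _ _ _ _

/-- The inhomogeneous cochain of a homogeneous 2-cochain. -/
def inhom {t : ℕ+} (σ : (homogeneousCochains (trivialRepSq G t)).X 2) (p : G × G) :
    Fin 2 → ZMod (t : ℕ) := homEval σ 1 p.1 (p.1 * p.2)

lemma inhom_mem_Z2 [LocallyCompactSpace G] {t : ℕ+}
    (σ : (homogeneousCochains (trivialRepSq G t)).X 2)
    (hσ : (homogeneousCochains (trivialRepSq G t)).d 2 3 σ = 0) :
    inhom σ ∈ Z2 G (Fin 2 → ZMod (t : ℕ)) := by
  refine ⟨?_, fun g h k => ?_⟩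
  · let s : C(G, C(G, Fin 2 → ZMod (t : ℕ))) :=
      (show C(G, C(G, C(G, Fin 2 → ZMod (t : ℕ)))) from σ.1) 1
    have h1 : Continuous fun p : G × G => s p.1 p.2 :=
      ContinuousMap.continuous_uncurry_of_continuous s
    exact h1.comp (by fun_prop : Continuous fun p : G × G => (p.1, p.1 * p.2))
  -- The vertices `1, g, gh, ghk` turn the homogeneous identity into the inhomogeneous one, once
  -- invariance strips `g` from the face omitting `1`.
  · have h1 := homEval_cocycle σ hσ 1 g (g * h) (g * h * k)
    have h2 := homEval_invariant σ g 1 h (h * k)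
    simp only [mul_one, ← mul_assoc] at h2
    rw [h2] at h1
    simp only [inhom, ← mul_assoc]
    linear_combination (exp := 1) -h1

/-- A homogeneous 2-cochain is a coboundary if its inhomogeneous cochain is. -/
lemma exists_eq_d_of_inhom_mem_B2 {t : ℕ+}
    (σ : (homogeneousCochains (trivialRepSq G t)).X 2)
    (hσ : inhom σ ∈ B2 G (Fin 2 → ZMod (t : ℕ))) :
    ∃ τ : (homogeneousCochains (trivialRepSq G t)).X 1,
      σ = (homogeneousCochains (trivialRepSq G t)).d 1 2 τ := by
  obtain ⟨β, hβ, h⟩ := hσ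
  let τ₀ : C(G, C(G, Fin 2 → ZMod (t : ℕ))) :=
    ContinuousMap.curry ⟨fun p : G × G => β (p.1⁻¹ * p.2), by fun_prop⟩
  have hτ : ∀ x y, τ₀ x y = β (x⁻¹ * y) := fun _ _ => rfl
  have hinv : τ₀ ∈ (resolutionX (trivialRepSq G t) 2).ρ.invariants := by
    intro g
    refine ContinuousMap.ext fun x => ContinuousMap.ext fun y => ?_
    change τ₀ (g⁻¹ * x) (g⁻¹ * y) = τ₀ x y
    simp [hτ, mul_assoc]
  refine ⟨⟨τ₀, hinv⟩, ?_⟩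
  apply Subtype.ext
  refine ContinuousMap.ext fun x => ContinuousMap.ext fun y => ContinuousMap.ext fun z => ?_
  refine Eq.trans ?_ (homEval_d ⟨τ₀, hinv⟩ x y z).symm
  change homEval σ x y z = τ₀ y z - τ₀ x z + τ₀ x y
  have h1 := homEval_invariant σ x⁻¹ x y z
  have h2 := h (x⁻¹ * y) (y⁻¹ * z)
  simp only [inhom, mul_assoc, mul_inv_cancel_left] at h2
  rw [← h1, inv_mul_cancel, h2, hτ, hτ, hτ]
  abel

/-- If `φ^* f - z f` is a coboundary for every 2-cocycle `f`, then `φ^*` is multiplication by `z`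
on `H²`. -/
theorem H2map_eq_smul [LocallyCompactSpace G] (φ : G →ₜ* G) (t : ℕ+) (z : ℤ)
    (h : ∀ f ∈ Z2 G (Fin 2 → ZMod (t : ℕ)),
      f ∘ Prod.map φ φ - z • f ∈ B2 G (Fin 2 → ZMod (t : ℕ))) (c : H2 G t) :
    H2map φ t c = (z : ZMod (t : ℕ)) • c := by
  let C := homogeneousCochains (trivialRepSq G t)
  obtain ⟨x, rfl⟩ := TopModuleCat.homologyπ_surjective C 2 c
  let F : TopRep.res (φ : G →* G) (trivialRepSq G t) ⟶ trivialRepSq G t := (TopRep.ofHom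
      { toContinuousLinearMap := ContinuousLinearMap.id (ZMod (t : ℕ)) (Fin 2 → ZMod (t : ℕ))
        isIntertwining' := fun _ => rfl })
  have h1 : H2map φ t (C.homologyπ 2 x) =
      C.homologyπ 2 (ContinuousCohomology.cocyclesMap φ F 2 x) :=
    congr($(ContinuousCohomology.π_map φ F 2) x)
  rw [h1, ← map_smul]
  have h2 : C.iCycles 2 (ContinuousCohomology.cocyclesMap φ F 2 x) =
      (ContinuousCohomology.cochainsMap φ F).f 2 (C.iCycles 2 x) :=
    congr($(HomologicalComplex.cyclesMap_i (ContinuousCohomology.cochainsMap φ F) 2) x)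
  have h3 : C.d 2 3 (C.iCycles 2 x) = 0 := congr($(C.iCycles_d 2 3) x)
  obtain ⟨τ, hτ⟩ := exists_eq_d_of_inhom_mem_B2
    (C.iCycles 2 (ContinuousCohomology.cocyclesMap φ F 2 x) -
      C.iCycles 2 ((z : ZMod (t : ℕ)) • x)) (by
    have := h _ (inhom_mem_Z2 (C.iCycles 2 x) h3)
    convert this using 1
    funext p
    rw [h2, map_smul]
    have e1 : inhom ((ContinuousCohomology.cochainsMap φ F).f 2 (C.iCycles 2 x)) p
      = inhom (C.iCycles 2 x) (φ p.1, φ p.2) := by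
      change homEval (C.iCycles 2 x) (φ 1) (φ p.1) (φ (p.1 * p.2)) = _
      rw [map_one, map_mul]
      rfl
    have e2 : inhom ((z : ZMod (t : ℕ)) • C.iCycles 2 x) p
      = (z : ZMod (t : ℕ)) • inhom (C.iCycles 2 x) p := rfl
    have e3 : ∀ σ σ' : C.X 2, inhom (σ - σ') p = inhom σ p - inhom σ' p := fun _ _ => rfl
    rw [e3, e1, e2, Int.cast_smul_eq_zsmul]
    rfl)
  exact TopModuleCat.homologyπ_eq_of_sub_eq_d C 1 _ _ τ hτ

end Bridge

/-! ### Central extensions attached to cocycles, and the values of relators in them -/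

section CocycleExtension

variable {G : Type*} [Group G] [TopologicalSpace G] {A : Type*} [AddCommGroup A]
  [TopologicalSpace A] [IsTopologicalAddGroup A]

namespace Z2

lemma continuous (f : Z2 G A) : Continuous f.1 := f.2.1

lemma cocycle (f : Z2 G A) (g h k : G) :
    f.1 (g, h) + f.1 (g * h, k) = f.1 (h, k) + f.1 (g, h * k) := f.2.2 g h k

lemma one_left (f : Z2 G A) (g : G) : f.1 (1, g) = f.1 (1, 1) := by
  have := Z2.cocycle f 1 1 g
  simp only [one_mul, add_left_inj] at this
  exact this.symm

lemma one_right (f : Z2 G A) (g : G) : f.1 (g, 1) = f.1 (1, 1) := by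
  have := Z2.cocycle f g 1 1
  simpa using this

/-- Pushforward of cocycles along a homomorphism of coefficients. -/
def map {A' : Type*} [AddCommGroup A'] [TopologicalSpace A'] [IsTopologicalAddGroup A']
    (θ : A →+ A') (hθ : Continuous θ) : Z2 G A →+ Z2 G A' where
  toFun f := ⟨θ ∘ f.1, hθ.comp (Z2.continuous f), fun g h k => by
    simp only [Function.comp_apply, ← map_add, Z2.cocycle f]⟩
  map_zero' := by ext; simp
  map_add' f f' := by ext; simp

/-- Pullback of cocycles along a continuous endomorphism. -/
def comap (φ : G →ₜ* G) : Z2 G A →+ Z2 G A where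
  toFun f := ⟨f.1 ∘ Prod.map φ φ, (Z2.continuous f).comp (φ.continuous.prodMap φ.continuous),
    fun g h k => by simp [Z2.cocycle f]⟩
  map_zero' := by ext; simp
  map_add' f f' := by ext; simp

lemma comap_apply (φ : G →ₜ* G) (f : Z2 G A) (p : G × G) :
    (comap φ f).1 p = f.1 (φ p.1, φ p.2) := rfl

end Z2

/-- The central extension of `G` by `A` defined by a 2-cocycle. -/
@[ext]
structure CocycleExtension (f : Z2 G A) where
  /-- The component in the coefficient group. -/
  fst : A
  /-- The component in the group. -/
  snd : G

namespace CocycleExtension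

variable (f : Z2 G A)

/-- The extension as a product set. -/
def toProd : CocycleExtension f ≃ A × G where
  toFun p := (p.fst, p.snd)
  invFun p := ⟨p.1, p.2⟩

instance : TopologicalSpace (CocycleExtension f) := .induced (toProd f) inferInstance

/-- The extension is a product as a topological space. -/
def homeoProd : CocycleExtension f ≃ₜ A × G := (toProd f).toHomeomorphOfIsInducing ⟨rfl⟩

lemma continuous_fst : Continuous (fst : CocycleExtension f → A) :=
  _root_.continuous_fst.comp (homeoProd f).continuous

lemma continuous_snd : Continuous (snd : CocycleExtension f → G) :=
  _root_.continuous_snd.comp (homeoProd f).continuous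

instance : Mul (CocycleExtension f) := ⟨fun p q => ⟨p.1 + q.1 + f.1 (p.2, q.2), p.2 * q.2⟩⟩

/-- Cocycles are not normalised, so the unit has first coordinate `-f (1, 1)`; this is the source of
the corrections by `f (1, 1)` in `incl` and `wordInv`. -/
instance : One (CocycleExtension f) := ⟨⟨-f.1 (1, 1), 1⟩⟩

instance : Inv (CocycleExtension f) :=
  ⟨fun p => ⟨-p.1 - f.1 (p.2⁻¹, p.2) - f.1 (1, 1), p.2⁻¹⟩⟩

variable {f}

@[simp] lemma mul_fst (p q : CocycleExtension f) : (p * q).1 = p.1 + q.1 + f.1 (p.2, q.2) := rfl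

@[simp] lemma mul_snd (p q : CocycleExtension f) : (p * q).2 = p.2 * q.2 := rfl

@[simp] lemma one_fst : (1 : CocycleExtension f).1 = -f.1 (1, 1) := rfl

@[simp] lemma one_snd : (1 : CocycleExtension f).2 = 1 := rfl

@[simp] lemma inv_fst (p : CocycleExtension f) :
    p⁻¹.1 = -p.1 - f.1 (p.2⁻¹, p.2) - f.1 (1, 1) := rfl

@[simp] lemma inv_snd (p : CocycleExtension f) : p⁻¹.2 = p.2⁻¹ := rfl

variable (f)

instance : Group (CocycleExtension f) := Group.ofLeftAxioms
  (fun p q s => by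
    refine CocycleExtension.ext ?_ (mul_assoc _ _ _)
    have := Z2.cocycle f p.2 q.2 s.2
    simp only [mul_fst, mul_snd]
    have e : p.1 + q.1 + f.1 (p.2, q.2) + s.1 + f.1 (p.2 * q.2, s.2) =
      p.1 + q.1 + s.1 + (f.1 (p.2, q.2) + f.1 (p.2 * q.2, s.2)) := by abel
    rw [e, this]
    abel)
  (fun p => by
    refine CocycleExtension.ext ?_ (one_mul _)
    simp only [mul_fst, one_fst, one_snd, Z2.one_left f]
    abel)
  (fun p => by
    refine CocycleExtension.ext ?_ (inv_mul_cancel _)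
    simp only [mul_fst, one_fst, inv_fst, inv_snd]
    abel)

instance [IsTopologicalGroup G] : IsTopologicalGroup (CocycleExtension f) where
  continuous_mul := by
    have h0 := Z2.continuous f
    have h1 := continuous_fst f
    have h2 := continuous_snd f
    rw [(homeoProd f).isInducing.continuous_iff]
    change Continuous fun p : CocycleExtension f × CocycleExtension f =>
      (p.1.1 + p.2.1 + f.1 (p.1.2, p.2.2), p.1.2 * p.2.2)
    fun_prop
  continuous_inv := by
    have h0 := Z2.continuous f
    have h1 := continuous_fst f
    have h2 := continuous_snd f
    rw [(homeoProd f).isInducing.continuous_iff]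
    change Continuous fun p : CocycleExtension f =>
      (-p.1 - f.1 (p.2⁻¹, p.2) - f.1 (1, 1), p.2⁻¹)
    fun_prop

instance [CompactSpace A] [CompactSpace G] : CompactSpace (CocycleExtension f) :=
  (homeoProd f).symm.compactSpace

instance [TotallyDisconnectedSpace A] [TotallyDisconnectedSpace G] :
    TotallyDisconnectedSpace (CocycleExtension f) :=
  (homeoProd f).symm.totallyDisconnectedSpace

/-- The projection of the extension to `G`. -/
def proj : CocycleExtension f →* G where
  toFun p := p.2
  map_one' := rfl
  map_mul' _ _ := rfl

/-- The inclusion of the kernel `A` into the extension. -/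
def incl : Multiplicative A →* CocycleExtension f where
  toFun a := ⟨a.toAdd - f.1 (1, 1), 1⟩
  map_one' := by ext <;> simp
  map_mul' a b := by
    refine CocycleExtension.ext ?_ (one_mul _).symm
    simp only [mul_fst, toAdd_mul]
    abel

lemma incl_mul (a : Multiplicative A) (p : CocycleExtension f) :
    incl f a * p = ⟨a.toAdd + p.1, p.2⟩ := by
  refine CocycleExtension.ext ?_ (one_mul _)
  simp only [mul_fst, incl, MonoidHom.coe_mk, OneHom.coe_mk, Z2.one_left f]
  abel

lemma mul_incl (a : Multiplicative A) (p : CocycleExtension f) :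
    p * incl f a = ⟨a.toAdd + p.1, p.2⟩ := by
  refine CocycleExtension.ext ?_ (mul_one _)
  simp only [mul_fst, incl, MonoidHom.coe_mk, OneHom.coe_mk, Z2.one_right f]
  abel

lemma commute_incl (a : Multiplicative A) (p : CocycleExtension f) : Commute (incl f a) p :=
  (incl_mul f a p).trans (mul_incl f a p).symm

lemma eq_incl_of_snd_eq_one (p : CocycleExtension f) (hp : p.2 = 1) :
    p = incl f (.ofAdd (p.1 + f.1 (1, 1))) := by
  refine CocycleExtension.ext ?_ hp
  simp [incl]

lemma incl_injective : Function.Injective (incl f) := fun a b h => by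
  have := congr_arg CocycleExtension.fst h
  simpa [incl] using this

variable {Γ : Type*} (q : Γ → G)

/-- The word `w` evaluated at the standard lifts of the elements `q γ`. -/
def word : FreeGroup Γ →* CocycleExtension f := FreeGroup.lift fun γ => ⟨0, q γ⟩

lemma word_of (γ : Γ) : word f q (.of γ) = ⟨0, q γ⟩ := FreeGroup.lift_apply_of

lemma word_snd (w : FreeGroup Γ) : (word f q w).2 = FreeGroup.lift q w := by
  have : (proj f).comp (word f q) = FreeGroup.lift q := by
    ext γ
    simp [word_of, proj]
  exact congr($this w)

/-- The element of `A` that a word `w` with trivial value in `G` represents in the extension. -/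
def wordInv (w : FreeGroup Γ) : Z2 G A →+ A where
  toFun f := (word f q w).1 + f.1 (1, 1)
  map_zero' := by
    have : (word (0 : Z2 G A) q w).1 = 0 := by
      induction w using FreeGroup.induction_on with
      | C1 => simp 
      | of γ => simp [word_of]
      | inv_of γ _ => simp [word_of]
      | mul x y hx hy => simp [hx, hy]
    simp [this]
  map_add' f f' := by
    have : (word (f + f') q w).1 = (word f q w).1 + (word f' q w).1 := by
      induction w using FreeGroup.induction_on with
      | C1 => simp ; abel
      | of γ => simp [word_of]
      | inv_of γ _ => simp [word_of]; abel
      | mul x y hx hy => simp [hx, hy, word_snd]; abel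
    simp only [this, AddSubgroup.coe_add, Pi.add_apply]
    abel

lemma wordInv_map {A' : Type*} [AddCommGroup A'] [TopologicalSpace A'] [IsTopologicalAddGroup A']
    (θ : A →+ A') (hθ : Continuous θ) (w : FreeGroup Γ) :
    wordInv q w (Z2.map θ hθ f) = θ (wordInv q w f) := by
  have h0 : ∀ p, (Z2.map θ hθ f).1 p = θ (f.1 p) := fun _ => rfl
  have : (word (Z2.map θ hθ f) q w).1 = θ (word f q w).1 := by
    induction w using FreeGroup.induction_on with
    | C1 => simp [h0]
    | of γ => simp [word_of]
    | inv_of γ _ => simp [word_of, h0]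
    | mul x y hx hy => simp [hx, hy, word_snd, h0]
  simp [wordInv, this, h0]

lemma word_eq_incl (w : FreeGroup Γ) (hw : FreeGroup.lift q w = 1) :
    word f q w = incl f (.ofAdd (wordInv q w f)) :=
  eq_incl_of_snd_eq_one f _ (by rw [word_snd, hw])

/-- The map `(a, g) ↦ a + β g` is a homomorphism that retracts the extension onto `A`, so the
invariant can be computed inside `A`. -/
lemma wordInv_of_coboundary (β : G → A) (hβ : ∀ g h, f.1 (g, h) = β g + β h - β (g * h))
    (w : FreeGroup Γ) (hw : FreeGroup.lift q w = 1) :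
    wordInv q w f = (FreeGroup.lift (fun γ => Multiplicative.ofAdd (β (q γ))) w).toAdd := by
  let χ : CocycleExtension f →* Multiplicative A :=
    { toFun p := .ofAdd (p.1 + β p.2)
      map_one' := by
        have := hβ 1 1
        simp only [mul_one] at this
        simp [this]
      map_mul' p q := by
        rw [← ofAdd_add, mul_fst, mul_snd, hβ]
        congr 1
        abel }
  have h1 : χ.comp (word f q) = FreeGroup.lift (fun γ => Multiplicative.ofAdd (β (q γ))) := by
    ext γ
    simp [χ, word_of]
  rw [← h1, MonoidHom.comp_apply, word_eq_incl f q w hw]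
  have := hβ 1 1
  simp only [mul_one] at this
  simp [χ, incl, this]

/-- The map of extensions covering an endomorphism of `G`. -/
def comapHom (φ : G →ₜ* G) : CocycleExtension (Z2.comap φ f) →* CocycleExtension f where
  toFun p := ⟨p.1, φ p.2⟩
  map_one' := CocycleExtension.ext (by simp [Z2.comap_apply]) (map_one φ)
  map_mul' p q := CocycleExtension.ext (by simp [Z2.comap_apply]) (map_mul φ _ _)

lemma comapHom_incl (φ : G →ₜ* G) (a : Multiplicative A) :
    comapHom f φ (incl _ a) = incl f a :=
  CocycleExtension.ext (by simp [comapHom, incl, Z2.comap_apply]) (by simp [comapHom, incl])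

/-- If `φ x` is conjugate to `x ^ k` then `φ^*` multiplies the invariant of `x ^ m = 1` by `k`,
up to multiples of `m`. -/
lemma exists_wordInv_comap_pow (φ : G →ₜ* G) (γ : Γ) (m : ℕ) (k : ℤ) (hm : q γ ^ m = 1)
    (hφ : IsConj (q γ ^ k) (φ (q γ))) :
    ∃ d : A, wordInv q (.of γ ^ m) (Z2.comap φ f) = k • wordInv q (.of γ ^ m) f + m • d := by
  obtain ⟨y, hy⟩ := isConj_iff.1 hφ
  have hw : FreeGroup.lift q (.of γ ^ m) = 1 := by simpa using hm
  let s : CocycleExtension f := word f q (.of γ)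
  let Y : CocycleExtension f := ⟨0, y⟩
  let z : CocycleExtension f := comapHom f φ (word _ q (.of γ))
  have hz : z.2 = (Y * s ^ k * Y⁻¹).2 := by
    change φ (word (Z2.comap φ f) q (.of γ)).2 = proj f (Y * s ^ k * Y⁻¹)
    rw [map_mul, map_mul, map_zpow, map_inv]
    have h1 : proj f s = q γ := by simp [s, word_of, proj]
    have h2 : proj f Y = y := rfl
    rw [h1, h2, hy, word_snd, FreeGroup.lift_apply_of]
  -- Both `z` and `Y s^k Y⁻¹` lie over `φ (q γ)`, so they differ by a central element, whose `m`-th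
  -- power is the error term. Conjugation by `Y` does not affect the central element `s ^ m`.
  have hz' : z = incl f (.ofAdd (z.1 - (Y * s ^ k * Y⁻¹).1)) * (Y * s ^ k * Y⁻¹) := by
    rw [incl_mul]
    exact CocycleExtension.ext (by simp) hz
  refine ⟨z.1 - (Y * s ^ k * Y⁻¹).1, ?_⟩
  have h1 : z ^ m = incl f (.ofAdd (wordInv q (.of γ ^ m) (Z2.comap φ f))) := by
    rw [← map_pow, ← map_pow, word_eq_incl _ q _ hw, comapHom_incl]
  have h2 : s ^ m = incl f (.ofAdd (wordInv q (.of γ ^ m) f)) := by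
    rw [← map_pow, word_eq_incl _ q _ hw]
  have h3 : (Y * s ^ k * Y⁻¹) ^ m = incl f (.ofAdd (k • wordInv q (.of γ ^ m) f)) := by
    rw [conj_pow, ← zpow_natCast, ← zpow_mul, mul_comm, zpow_mul, zpow_natCast, h2, ← map_zpow,
      ← (commute_incl f _ Y).eq, mul_inv_cancel_right]
    rfl
  rw [hz', (commute_incl f _ _).mul_pow, h3, ← map_pow, ← map_mul] at h1
  have h4 := congr_arg Multiplicative.toAdd (incl_injective f h1)
  simp only [toAdd_mul, toAdd_pow, toAdd_ofAdd] at h4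
  rw [← h4, add_comm]

end CocycleExtension

end CocycleExtension

/-! ### Classes on the profinite orbifold group and their invariants -/

namespace OrbifoldSignature

open CocycleExtension

variable (B : OrbifoldSignature)

/-- The map from the orbifold fundamental group to its profinite completion. -/
def toProfinite : B.FundamentalGroup →* B.ProfiniteGroup where
  toFun := ProfiniteGrp.ProfiniteCompletion.etaFn (GrpCat.of B.FundamentalGroup)
  map_one' := rfl
  map_mul' _ _ := rfl

lemma denseRange_toProfinite : DenseRange B.toProfinite :=
  ProfiniteGrp.ProfiniteCompletion.denseRange (GrpCat.of B.FundamentalGroup)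

/-- The images of the generators in the profinite completion. -/
def profiniteGen (γ : B.Gen) : B.ProfiniteGroup := B.toProfinite (PresentedGroup.of γ)

lemma lift_profiniteGen (w : FreeGroup B.Gen) :
    FreeGroup.lift B.profiniteGen w = B.toProfinite (PresentedGroup.mk B.relators w) := by
  have : FreeGroup.lift B.profiniteGen =
      B.toProfinite.comp (PresentedGroup.mk B.relators) := by
    ext γ
    simp only [FreeGroup.lift_apply_of]
    rfl
  rw [this]
  rfl

lemma lift_profiniteGen_eq_one {w : FreeGroup B.Gen} (hw : w ∈ B.relators) :
    FreeGroup.lift B.profiniteGen w = 1 := by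
  rw [lift_profiniteGen, PresentedGroup.one_of_mem hw, map_one]

variable {B}

lemma pow_mem_relators (i : Fin B.numCone) :
    FreeGroup.of (Gen.x i) ^ (B.order i : ℕ) ∈ B.relators := Or.inl ⟨i, rfl⟩

lemma longRelator_mem_relators : B.longRelator ∈ B.relators := Or.inr rfl

lemma profiniteGen_pow (i : Fin B.numCone) :
    B.profiniteGen (Gen.x i) ^ (B.order i : ℕ) = 1 := by
  simpa using B.lift_profiniteGen_eq_one (pow_mem_relators i)

/-- The universal property of the profinite completion. -/
lemma exists_profinite_lift {P : Type} [Group P] [TopologicalSpace P] [IsTopologicalGroup P]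
    [CompactSpace P] [TotallyDisconnectedSpace P] (ρ : FreeGroup B.Gen →* P)
    (hρ : ∀ w ∈ B.relators, ρ w = 1) :
    ∃ h : B.ProfiniteGroup →* P, Continuous h ∧
      ∀ w, h (B.toProfinite (PresentedGroup.mk B.relators w)) = ρ w := by
  let ρ' : B.FundamentalGroup →* P := QuotientGroup.lift (Subgroup.normalClosure B.relators) ρ
    (Subgroup.normalClosure_le_normal (N := ρ.ker) hρ)
  let F : GrpCat.of B.FundamentalGroup ⟶ GrpCat.of (ProfiniteGrp.of P) := GrpCat.ofHom ρ'
  let h := ProfiniteGrp.ProfiniteCompletion.lift F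
  refine ⟨h.hom.toMonoidHom, h.hom.continuous_toFun, fun w => ?_⟩
  exact congr($(ProfiniteGrp.ProfiniteCompletion.lift_eta F) (PresentedGroup.mk B.relators w))

section

variable {A : Type} [AddCommGroup A] [TopologicalSpace A] [IsTopologicalAddGroup A]

/-- A cocycle is a coboundary if its invariants on the relators are those of a homomorphism from
the free group. -/
lemma mem_B2_of_wordInv [CompactSpace A] [TotallyDisconnectedSpace A]
    (f : Z2 B.ProfiniteGroup A) (χ : FreeGroup B.Gen →* Multiplicative A)
    (hχ : ∀ w ∈ B.relators, wordInv B.profiniteGen w f = (χ w).toAdd) :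
    f.1 ∈ B2 B.ProfiniteGroup A := by
  -- Correcting the lifts by `χ` kills all relators, so `ρ` extends to the completion; by density
  -- the extension is a section of the projection, and its first coordinate, negated, trivialises
  -- `f`.
  let ρ : FreeGroup B.Gen →* CocycleExtension f :=
    { toFun w := (incl f (χ w))⁻¹ * word f B.profiniteGen w
      map_one' := by simp only [map_one, inv_one, mul_one]
      map_mul' v w := by
        have h1 := (commute_incl f (χ w) (word f B.profiniteGen v)).inv_left.eq
        have h2 := ((commute_incl f (χ v) (incl f (χ w))).inv_left).inv_right.eq
        simp only [map_mul, mul_inv_rev, mul_assoc]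
        rw [← mul_assoc _ (incl f (χ w))⁻¹, ← h1, ← mul_assoc, ← mul_assoc, ← mul_assoc, ← h2]
        simp only [mul_assoc] }
  have hρ : ∀ w ∈ B.relators, ρ w = 1 := fun w hw => by
    change (incl f (χ w))⁻¹ * word f B.profiniteGen w = 1
    rw [word_eq_incl f _ w (B.lift_profiniteGen_eq_one hw), hχ w hw, ofAdd_toAdd, inv_mul_cancel]
  obtain ⟨h, hc, hh⟩ := exists_profinite_lift ρ hρ
  have hsnd : ∀ g, (h g).2 = g := by
    refine congr_fun (B.denseRange_toProfinite.equalizer ((continuous_snd f).comp hc)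
      continuous_id (funext fun x => ?_))
    obtain ⟨w, rfl⟩ := PresentedGroup.mk_surjective B.relators x
    simp only [Function.comp_apply, hh]
    rw [← lift_profiniteGen, ← word_snd f]
    simp [ρ, incl]
  refine ⟨fun g => -(h g).1, ((continuous_fst f).comp hc).neg, fun g g' => ?_⟩
  have := congr_arg CocycleExtension.fst (map_mul h g g')
  simp only [mul_fst, hsnd] at this
  change _ = -(h g).1 + -(h g').1 - -(h (g * g')).1
  rw [this]
  abel

/-- `f` has the invariants `a i` (for `x_i ^ m_i = 1`) and `b` (for the long relator), up to the
choice of lifts of the generators. -/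
def HasInvariants (f : Z2 B.ProfiniteGroup A) (a : Fin B.numCone → A) (b : A) : Prop :=
  ∃ c : Fin B.numCone → A,
    (∀ i, wordInv B.profiniteGen (.of (Gen.x i) ^ (B.order i : ℕ)) f =
      a i + (B.order i : ℕ) • c i) ∧
    wordInv B.profiniteGen B.longRelator f = b + ∑ i, c i

lemma map_longRelator {M : Type*} [CommGroup M] (χ : FreeGroup B.Gen →* M) :
    χ B.longRelator = ∏ i, χ (.of (Gen.x i)) := by
  simp only [longRelator, map_mul, map_list_prod, List.map_ofFn, List.prod_ofFn]
  rw [Finset.prod_eq_one (s := Finset.univ) (f := _ ∘ fun j => _ * _ * _ * _), mul_one]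
  · rfl
  · intro j _
    simp [mul_comm (χ (.of (Gen.u j)))]

namespace HasInvariants

variable {f f' : Z2 B.ProfiniteGroup A} {a a' : Fin B.numCone → A} {b b' : A}

lemma exists_of (f : Z2 B.ProfiniteGroup A) : ∃ a b, HasInvariants f a b :=
  ⟨_, _, 0, fun i => by rw [Pi.zero_apply, smul_zero, add_zero], by simp; rfl⟩

lemma add (h : HasInvariants f a b) (h' : HasInvariants f' a' b') :
    HasInvariants (f + f') (a + a') (b + b') := by
  obtain ⟨c, hc, hb⟩ := h
  obtain ⟨c', hc', hb'⟩ := h'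
  refine ⟨c + c', fun i => ?_, ?_⟩
  · simp only [map_add, hc, hc', Pi.add_apply, smul_add]; abel
  · simp only [map_add, hb, hb', Pi.add_apply, Finset.sum_add_distrib]; abel

lemma zero : HasInvariants (0 : Z2 B.ProfiniteGroup A) 0 0 :=
  ⟨0, fun i => by simp, by simp⟩

lemma sum {ι : Type*} (s : Finset ι) (f : ι → Z2 B.ProfiniteGroup A)
    (a : ι → Fin B.numCone → A) (b : ι → A) (h : ∀ j, HasInvariants (f j) (a j) (b j)) :
    HasInvariants (∑ j ∈ s, f j) (∑ j ∈ s, a j) (∑ j ∈ s, b j) := by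
  classical
  induction s using Finset.induction_on with
  | empty => simpa using zero
  | insert j s hj ih => simpa only [Finset.sum_insert hj] using (h j).add ih

lemma zsmul (n : ℤ) (h : HasInvariants f a b) : HasInvariants (n • f) (n • a) (n • b) := by
  obtain ⟨c, hc, hb⟩ := h
  refine ⟨n • c, fun i => ?_, ?_⟩
  · rw [map_zsmul, hc, smul_add, Pi.smul_apply, Pi.smul_apply, smul_comm]
  · simp only [map_zsmul, hb, Pi.smul_apply, Finset.smul_sum, smul_add]

lemma sub (h : HasInvariants f a b) (h' : HasInvariants f' a' b') :
    HasInvariants (f - f') (a - a') (b - b') := by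
  have := h.add (h'.zsmul (-1))
  simpa [sub_eq_add_neg] using this

lemma map {A' : Type} [AddCommGroup A'] [TopologicalSpace A'] [IsTopologicalAddGroup A']
    (θ : A →+ A') (hθ : Continuous θ) (h : HasInvariants f a b) :
    HasInvariants (Z2.map θ hθ f) (θ ∘ a) (θ b) := by
  obtain ⟨c, hc, hb⟩ := h
  refine ⟨θ ∘ c, fun i => ?_, ?_⟩
  · simp [wordInv_map, hc]
  · simp [wordInv_map, hb]

/-- Invariants may be changed by those of a change of lifts. -/
lemma shift (h : HasInvariants f a b) (c : Fin B.numCone → A)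
    (ha : ∀ i, a' i = a i + (B.order i : ℕ) • c i) (hb : b' = b + ∑ i, c i) :
    HasInvariants f a' b' := by
  obtain ⟨d, hd, hd'⟩ := h
  refine ⟨d - c, fun i => ?_, ?_⟩
  · rw [hd, ha, Pi.sub_apply, smul_sub]; abel
  · simp only [hd', hb, Pi.sub_apply, Finset.sum_sub_distrib]; abel

lemma mem_B2 [CompactSpace A] [TotallyDisconnectedSpace A] (h : HasInvariants f 0 0) :
    f.1 ∈ B2 B.ProfiniteGroup A := by
  obtain ⟨c, hc, hb⟩ := h
  let χ : FreeGroup B.Gen →* Multiplicative A := FreeGroup.lift fun γ =>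
    match γ with
    | .x i => .ofAdd (c i)
    | .u _ => 1
    | .v _ => 1
  refine mem_B2_of_wordInv f χ fun w hw => ?_
  rcases hw with ⟨i, rfl⟩ | rfl
  · rw [hc]; simp [χ]
  · rw [hb, map_longRelator]; simp [χ]

lemma of_mem_B2 (h : f.1 ∈ B2 B.ProfiniteGroup A) : HasInvariants f 0 0 := by
  obtain ⟨β, -, hβ⟩ := h
  refine ⟨fun i => β (B.profiniteGen (Gen.x i)), fun i => ?_, ?_⟩
  · rw [wordInv_of_coboundary f _ β hβ _ (B.lift_profiniteGen_eq_one (pow_mem_relators i))]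
    simp
  · rw [wordInv_of_coboundary f _ β hβ _ (B.lift_profiniteGen_eq_one longRelator_mem_relators),
      map_longRelator]
    simp

/-- If `f` is a coboundary then its invariants are those of a change of lifts. -/
lemma exists_of_zero (h : HasInvariants f a b) (h0 : HasInvariants f 0 0) :
    ∃ c : Fin B.numCone → A, (∀ i, a i = (B.order i : ℕ) • c i) ∧ b = ∑ i, c i := by
  obtain ⟨c, hc, hb⟩ := h
  obtain ⟨d, hd, hd'⟩ := h0
  refine ⟨d - c, fun i => ?_, ?_⟩
  · have := (hc i).symm.trans (hd i)
    rw [Pi.zero_apply, zero_add] at this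
    rw [Pi.sub_apply, smul_sub, ← this]; abel
  · have := hb.symm.trans hd'
    rw [zero_add] at this
    simp only [Pi.sub_apply, Finset.sum_sub_distrib, ← this]; abel

/-- The errors `d i`, being multiplied by `m_i`, are absorbed into the choice of lifts. Nothing is
known about the long relator, so the second invariant is simply whatever comes out. -/
lemma comap (h : HasInvariants f a b) (φ : B.ProfiniteGroup →ₜ* B.ProfiniteGroup)
    (k : Fin B.numCone → ℤ) (hφ : ∀ i, IsConj (B.coneGen i ^ k i) (φ (B.coneGen i))) :
    ∃ b', HasInvariants (Z2.comap φ f) (fun i => k i • a i) b' := by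
  obtain ⟨c, hc, hb⟩ := h
  choose d hd using fun i => exists_wordInv_comap_pow f B.profiniteGen φ (Gen.x i)
    (B.order i) (k i) (profiniteGen_pow i) (hφ i)
  refine ⟨_, fun i => k i • c i + d i, fun i => ?_, (sub_add_cancel _ _).symm⟩
  rw [hd, hc, smul_add, smul_add, smul_comm (k i), add_assoc]

end HasInvariants

end

end OrbifoldSignature

/-! ### Cocycles from finite central extensions -/

namespace OrbifoldSignature

open CocycleExtension

variable {B : OrbifoldSignature}

/-- A finite central extension with lifts of the generators defines a cocycle on the profinite
completion. -/
lemma exists_hasInvariants_of_finite {A : Type} [AddCommGroup A] [TopologicalSpace A]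
    [IsTopologicalAddGroup A] {F : Type} [Group F] [Finite F] (ι : Multiplicative A →* F)
    (hι : Function.Injective ι) (hcomm : ∀ a x, Commute (ι a) x) (X : B.Gen → F)
    (a : Fin B.numCone → A) (b : A)
    (ha : ∀ i, X (Gen.x i) ^ (B.order i : ℕ) = ι (.ofAdd (a i)))
    (hb : FreeGroup.lift X B.longRelator = ι (.ofAdd b)) :
    ∃ f : Z2 B.ProfiniteGroup A, HasInvariants f a b := by
  have hn : ι.range.Normal := ⟨by
    rintro _ ⟨z, rfl⟩ g
    rw [← (hcomm z g).eq, mul_inv_cancel_right]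
    exact ⟨z, rfl⟩⟩
  let _ : TopologicalSpace (F ⧸ ι.range) := ⊥
  have : DiscreteTopology (F ⧸ ι.range) := ⟨rfl⟩
  let π := QuotientGroup.mk' ι.range
  have hπ : ∀ x y, π x = π y → ∃ z, x = ι z * y := fun x y h => by
    obtain ⟨z, hz⟩ := QuotientGroup.eq.1 h.symm
    exact ⟨z, by rw [(hcomm z y).eq, hz, mul_inv_cancel_left]⟩
  have hπι : ∀ z, π (ι z) = 1 := fun z => (QuotientGroup.eq_one_iff _).2 ⟨z, rfl⟩
  obtain ⟨h, hc, hh⟩ := exists_profinite_lift (B := B) (π.comp (FreeGroup.lift X)) (by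
    rintro _ (⟨i, rfl⟩ | rfl)
    · simp [ha, hπι]
    · simp [hb, hπι])
  obtain ⟨s, hs⟩ := (QuotientGroup.mk'_surjective ι.range).hasRightInverse
  change ∀ p, π (s p) = p at hs
  -- `c` is the factor set of the set-theoretic section `s`; its pullback along `h` is the required
  -- cocycle, continuous because the quotient is finite and discrete.
  choose c hc' using fun p q => hπ (s p * s q) (s (p * q)) (by simp only [map_mul, hs])
  have hcoc : ∀ p q r, c p q * c (p * q) r = c q r * c p (q * r) := fun p q r => by
    apply hι
    have h1 : s p * s q * s r = ι (c p q) * ι (c (p * q) r) * s (p * q * r) := by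
      rw [hc', mul_assoc, hc', ← mul_assoc]
    have h2 : s p * (s q * s r) = ι (c q r) * ι (c p (q * r)) * s (p * (q * r)) := by
      rw [hc' q r, ← mul_assoc, ← (hcomm _ (s p)).eq, mul_assoc, hc', ← mul_assoc]
    rw [mul_assoc, h2, mul_assoc p, mul_left_inj] at h1
    rw [map_mul, map_mul, h1]
  let f : Z2 B.ProfiniteGroup A := ⟨fun p => (c (h p.1) (h p.2)).toAdd, by
      have h1 : Continuous fun p : (F ⧸ ι.range) × (F ⧸ ι.range) => (c p.1 p.2).toAdd :=
        continuous_of_discreteTopology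
      exact h1.comp (hc.prodMap hc), fun x y z => by
      simp only [map_mul, ← toAdd_mul, hcoc]⟩
  have hf : ∀ p, f.1 p = (c (h p.1) (h p.2)).toAdd := fun _ => rfl
  let T : CocycleExtension f →* F := MonoidHom.mk' (fun p => ι (.ofAdd p.1) * s (h p.2))
    fun p q => by
      rw [mul_fst, mul_snd, hf, ofAdd_add, ofAdd_add, map_mul, map_mul, ofAdd_toAdd, mul_assoc,
        map_mul, ← hc', mul_assoc, mul_assoc, ← mul_assoc (ι _) (s _), (hcomm _ (s (h p.2))).eq,
        mul_assoc]
  have hs1 : s 1 = ι (c 1 1) := by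
    have := hc' 1 1
    rwa [mul_one, mul_left_inj] at this
  have hT : ∀ z, T (incl f z) = ι z := fun z => by
    change ι (.ofAdd (z.toAdd - f.1 (1, 1))) * s (h 1) = ι z
    rw [map_one, hs1, hf, ← map_mul]
    congr 1
    rw [ofAdd_sub, map_one, ofAdd_toAdd, ofAdd_toAdd, div_mul_cancel]
  have hgen : ∀ γ, π (s (h (B.profiniteGen γ))) = π (X γ) := fun γ => by
    rw [hs]
    exact (hh (.of γ)).trans (by simp)
  -- `d` compares the standard lifts of the generators, mapped to `F` by `T`, with the given
  -- elements `X`; it is the change of lifts allowed by `HasInvariants`.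
  choose d hd using fun γ => hπ _ _ (hgen γ)
  let χ : FreeGroup B.Gen →* Multiplicative A := FreeGroup.lift d
  have hTw : ∀ w, T (word f B.profiniteGen w) = ι (χ w) * FreeGroup.lift X w := by
    let R : FreeGroup B.Gen →* F := MonoidHom.mk' (fun w => ι (χ w) * FreeGroup.lift X w)
      fun v w => by
        simp only [map_mul, mul_assoc]
        rw [← mul_assoc (ι (χ w)) (FreeGroup.lift X v), (hcomm _ (FreeGroup.lift X v)).eq, mul_assoc]
    have : T.comp (word f B.profiniteGen) = R := by
      ext γ
      simp only [MonoidHom.comp_apply, word_of, R, MonoidHom.mk'_apply, χ, T,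
        FreeGroup.lift_apply_of]
      rw [← hd, ofAdd_zero, map_one, one_mul]
    exact fun w => congr($this w)
  have key : ∀ w ∈ B.relators, ∀ e, FreeGroup.lift X w = ι (.ofAdd e) →
      wordInv B.profiniteGen w f = e + (χ w).toAdd := fun w hw e he => by
    have := hTw w
    rw [word_eq_incl f _ w (B.lift_profiniteGen_eq_one hw), hT, he, ← map_mul] at this
    have := congr_arg Multiplicative.toAdd (hι this)
    rwa [toAdd_mul, toAdd_ofAdd, toAdd_ofAdd, add_comm] at this
  refine ⟨f, fun i => (d (Gen.x i)).toAdd, fun i => ?_, ?_⟩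
  · rw [key _ (pow_mem_relators i) (a i) (by simp [ha])]
    simp [χ]
  · rw [key _ longRelator_mem_relators b hb, map_longRelator]
    simp [χ]

/-! ### The degree of `φ` and the construction of `κ` -/

section Degree

variable {A : Type} [AddCommGroup A] [TopologicalSpace A] [IsTopologicalAddGroup A]

lemma Z2.comap_mem_B2 {f : Z2 B.ProfiniteGroup A} (φ : B.ProfiniteGroup →ₜ* B.ProfiniteGroup)
    (h : f.1 ∈ B2 B.ProfiniteGroup A) : (Z2.comap φ f).1 ∈ B2 B.ProfiniteGroup A := by
  obtain ⟨β, hβ, h⟩ := h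
  exact ⟨β ∘ φ, hβ.comp φ.continuous, fun x y => by simp [Z2.comap_apply, h]⟩

variable (B) in
/-- The product of the orders of the cone points. -/
def orderProd : ℕ := ∏ i, (B.order i : ℕ)

lemma order_dvd_orderProd (i : Fin B.numCone) : (B.order i : ℕ) ∣ B.orderProd :=
  Finset.dvd_prod_of_mem (fun i => (B.order i : ℕ)) (Finset.mem_univ i)

lemma orderProd_pos : 0 < B.orderProd := Finset.prod_pos fun i _ => (B.order i).pos

/-- Here `b` is a sum of elements `c i` with `m_i c_i = 0`. This bounds the indeterminacy of a
degree and is why degrees are taken at a level divisible by `t M`. -/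
lemma HasInvariants.orderProd_smul_eq_zero {f : Z2 B.ProfiniteGroup A} {b : A}
    (h : HasInvariants f 0 b) (h0 : HasInvariants f 0 0) : B.orderProd • b = 0 := by
  obtain ⟨c, hc, hb⟩ := h.exists_of_zero h0
  rw [hb, Finset.smul_sum]
  refine Finset.sum_eq_zero fun i _ => ?_
  obtain ⟨n, hn⟩ := order_dvd_orderProd i
  rw [hn, mul_comm, mul_smul, ← hc, Pi.zero_apply, smul_zero]

variable (φ : B.ProfiniteGroup →ₜ* B.ProfiniteGroup) (k : Fin B.numCone → ℤ)

/-- `φ^*` multiplies by `l` the class with invariants `(0, …, 0, 1)` modulo `N`. -/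
def IsDegree (N : ℕ) (l : ℤ) : Prop :=
  ∃ f : Z2 B.ProfiniteGroup (ZMod N), HasInvariants f 0 1 ∧ HasInvariants (Z2.comap φ f) 0 l

variable (hφ : ∀ i, IsConj (B.coneGen i ^ k i) (φ (B.coneGen i)))
  (hgood : ∀ (N : ℕ) [NeZero N] (a : Fin B.numCone → ZMod N) (b : ZMod N),
    ∃ f : Z2 B.ProfiniteGroup (ZMod N), HasInvariants f a b)

include hφ hgood in
lemma exists_isDegree (N : ℕ) [NeZero N] : ∃ l, IsDegree φ N l := by
  obtain ⟨f, hf⟩ := hgood N 0 1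
  obtain ⟨b, hb⟩ := hf.comap φ k hφ
  obtain ⟨l, rfl⟩ := ZMod.intCast_surjective b
  refine ⟨l, f, hf, ?_⟩
  convert hb using 1
  funext i
  simp

variable {φ k}

/-- The reduction of `f'` modulo `N` is cohomologous to `f`, so `l'` and `l` multiply the same class
in the same way. -/
lemma IsDegree.dvd {N N' : ℕ} [NeZero N] {l l' : ℤ} (h : IsDegree φ N l)
    (h' : IsDegree φ N' l') (hN : N ∣ N') : (N : ℤ) ∣ B.orderProd * (l' - l) := by
  obtain ⟨f, hf, hl⟩ := h
  obtain ⟨f', hf', hl'⟩ := h'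
  let θ : ZMod N' →+ ZMod N := (ZMod.castHom hN (ZMod N)).toAddMonoidHom
  have hθ : Continuous θ := continuous_of_discreteTopology
  have hθ1 : ∀ n : ℤ, θ n = n := fun n => map_intCast (ZMod.castHom hN (ZMod N)) n
  have hθ1' : θ 1 = 1 := map_one (ZMod.castHom hN (ZMod N))
  have h1 : HasInvariants (Z2.map θ hθ f' - f) 0 0 := by
    convert (hf'.map θ hθ).sub hf using 1
    · funext i; simp
    · rw [hθ1', sub_self]
  have h2 : HasInvariants (Z2.comap φ (Z2.map θ hθ f' - f)) 0 ((l' - l : ℤ) : ZMod N) := by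
    rw [map_sub]
    convert (hl'.map θ hθ).sub hl using 1
    · rfl
    · funext i; simp
    · rw [hθ1, Int.cast_sub]
  have h3 := h2.orderProd_smul_eq_zero (.of_mem_B2 (Z2.comap_mem_B2 φ h1.mem_B2))
  rw [← ZMod.intCast_zmod_eq_zero_iff_dvd]
  simpa using h3

include hφ hgood in
-- The link between `l` and `k i`: the class `f` is an eigenclass with eigenvalue `μ ≡ k i`, and
-- `m_i f` is minus the class with eigenvalue `l`.
lemma IsDegree.exists_cone {N : ℕ} [NeZero N] {l : ℤ} (h : IsDegree φ N l)
    (i : Fin B.numCone) :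
    ∃ (f : Z2 B.ProfiniteGroup (ZMod N)) (μ : ℤ), HasInvariants f (Pi.single i 1) 0 ∧
      HasInvariants (Z2.comap φ f) (μ • Pi.single i 1) 0 ∧
      ((B.order i : ℕ) : ℤ) ∣ μ - k i ∧ (N : ℤ) ∣ B.orderProd * (l - μ) := by
  obtain ⟨f₀, hf₀, hl⟩ := h
  obtain ⟨f, hf⟩ := hgood N (Pi.single i 1) 0
  obtain ⟨b, hb⟩ := hf.comap φ k hφ
  obtain ⟨β, rfl⟩ := ZMod.intCast_surjective b
  have hμ : HasInvariants (Z2.comap φ f) ((k i - (B.order i : ℕ) * β) • Pi.single i 1) 0 := by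
    -- Changing the lift of `x_i` moves the unknown second invariant `β` into the first, at the cost
    -- of `m_i β`, which is invisible modulo `m_i`.
    refine hb.shift (Pi.single i (-β)) (fun j => ?_) ?_
    · obtain rfl | hj := eq_or_ne j i
      · simp [sub_eq_add_neg]
      · simp [hj]
    · simp
  refine ⟨f, _, hf, hμ, ⟨-β, by ring⟩, ?_⟩
  generalize k i - (B.order i : ℕ) * β = μ at hμ
  have h1 : HasInvariants (((B.order i : ℕ) : ℤ) • f + f₀) 0 0 := by
    refine ((hf.zsmul _).add hf₀).shift (Pi.single i (-1)) (fun j => ?_) ?_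
    · obtain rfl | hj := eq_or_ne j i
      · simp
      · simp [hj]
    · simp
  have h2 : HasInvariants (Z2.comap φ (((B.order i : ℕ) : ℤ) • f + f₀)) 0
      ((l - μ : ℤ) : ZMod N) := by
    rw [map_add, map_zsmul]
    refine ((hμ.zsmul _).add hl).shift (Pi.single i (-μ)) (fun j => ?_) ?_
    · obtain rfl | hj := eq_or_ne j i
      · simp
      · simp [hj]
    · simp [sub_eq_add_neg]
  have h3 := h2.orderProd_smul_eq_zero (.of_mem_B2 (Z2.comap_mem_B2 φ h1.mem_B2))
  rw [← ZMod.intCast_zmod_eq_zero_iff_dvd]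
  simpa using h3

include hφ hgood in
-- Every class over `A` is a sum of pushforwards of the eigenclasses over `ℤ/N` along `1 ↦ a i` and
-- `1 ↦ b`, and all their eigenvalues act on `A` as `l`.
lemma IsDegree.comap_sub_mem_B2 [CompactSpace A] [TotallyDisconnectedSpace A] {t : ℕ} [NeZero t]
    (ht : ∀ a : A, t • a = 0) {l : ℤ} (h : IsDegree φ (t * B.orderProd ^ 2) l)
    (f : Z2 B.ProfiniteGroup A) :
    (Z2.comap φ f - l • f).1 ∈ B2 B.ProfiniteGroup A := by
  set N := t * B.orderProd ^ 2 with hN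
  have : NeZero N := ⟨mul_ne_zero (NeZero.ne t) (pow_ne_zero _ orderProd_pos.ne')⟩
  obtain ⟨a, b, hf⟩ := HasInvariants.exists_of f
  choose g μ hg hμ hk hdvd using h.exists_cone hφ hgood
  obtain ⟨f₀, hf₀, hl⟩ := h
  have hmul : ∀ (i) (x : A), μ i • x = l • x := fun i x => by
    have h1 : (t : ℤ) ∣ l - μ i := by
      have h2 : (B.orderProd : ℤ) * (t * B.orderProd) ∣ B.orderProd * (l - μ i) := by
        refine dvd_trans (Dvd.intro 1 ?_) (hdvd i)
        rw [hN]; push_cast; ring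
      exact dvd_trans (Dvd.intro _ rfl)
        (Int.dvd_of_mul_dvd_mul_left (by exact_mod_cast orderProd_pos.ne') h2)
    obtain ⟨e, he⟩ := h1
    rw [← sub_eq_zero, ← sub_smul, ← neg_sub, he, mul_comm, neg_smul, mul_smul, natCast_zsmul, ht,
      smul_zero, neg_zero]
  let θ : A → ZMod N →+ A := fun x => ZMod.lift N ⟨zmultiplesHom A x, by
    rw [hN, zmultiplesHom_apply, natCast_zsmul, mul_comm, mul_smul, ht, smul_zero]⟩
  have hθ : ∀ x, Continuous (θ x) := fun x => continuous_of_discreteTopology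
  have hθ1 : ∀ x (n : ℤ), θ x n = n • x := fun x n => by simp [θ]
  have hθ1' : ∀ x, θ x 1 = x := fun x => by simpa using hθ1 x 1
  let f' : Z2 B.ProfiniteGroup A := ∑ i, Z2.map (θ (a i)) (hθ _) (g i) + Z2.map (θ b) (hθ _) f₀
  have h1 : HasInvariants f' a b := by
    convert (HasInvariants.sum Finset.univ _ _ _ fun i => (hg i).map (θ (a i)) (hθ _)).add
      (hf₀.map (θ b) (hθ _)) using 1
    · funext j
      simp [Finset.sum_apply, Pi.single_apply, apply_ite, hθ1']
    · simp [hθ1']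
  have h2 : HasInvariants (Z2.comap φ f') (l • a) (l • b) := by
    have : Z2.comap φ f' = ∑ i, Z2.map (θ (a i)) (hθ _) (Z2.comap φ (g i)) +
        Z2.map (θ b) (hθ _) (Z2.comap φ f₀) := by
      simp only [f', map_add, map_sum]
      rfl
    rw [this]
    convert (HasInvariants.sum Finset.univ _ _ _ fun i => (hμ i).map (θ (a i)) (hθ _)).add
      (hl.map (θ b) (hθ _)) using 1
    · funext j
      simp [Finset.sum_apply, Pi.single_apply, hθ1, apply_ite, hmul]
    · simp [hθ1]
  have h3 : HasInvariants (f - f') 0 0 := by simpa using hf.sub h1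
  have h4 : HasInvariants (Z2.comap φ (f - f')) 0 0 := .of_mem_B2 (Z2.comap_mem_B2 φ h3.mem_B2)
  have h5 := (h4.add h2).sub (hf.zsmul l)
  rw [map_sub, sub_add_cancel, zero_add, zero_add, sub_self, sub_self] at h5
  exact h5.mem_B2

include hφ hgood in
/-- The main theorem for signatures for which all classes modulo `N` come from the profinite
completion. -/
theorem exists_profiniteInt :
    ∃ κ : ProfiniteInt,
      (∀ i, ProfiniteInt.toZMod (B.order i) κ = (k i : ZMod (B.order i : ℕ))) ∧
      ∀ (t : ℕ+) (c : H2 B.ProfiniteGroup t), H2map φ t c = ProfiniteInt.toZMod t κ • c := by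
  have hne : ∀ t : ℕ+, NeZero ((t : ℕ) * B.orderProd ^ 2) := fun t =>
    ⟨mul_ne_zero t.ne_zero (pow_ne_zero _ orderProd_pos.ne')⟩
  choose l hl using fun t : ℕ+ => exists_isDegree φ k hφ hgood ((t : ℕ) * B.orderProd ^ 2)
  have hcancel : ∀ (t : ℕ+) (e : ℤ),
      (((t : ℕ) * B.orderProd ^ 2 : ℕ) : ℤ) ∣ B.orderProd * e → ((t : ℕ) : ℤ) ∣ e := fun t e h => by
    have h2 : (B.orderProd : ℤ) * ((t : ℕ) * B.orderProd) ∣ B.orderProd * e := by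
      refine dvd_trans (Dvd.intro 1 ?_) h
      push_cast; ring
    exact dvd_trans (Dvd.intro _ rfl)
      (Int.dvd_of_mul_dvd_mul_left (by exact_mod_cast orderProd_pos.ne') h2)
  refine ⟨⟨fun t => (l t : ZMod (t : ℕ)), fun s t hst => ?_⟩, fun i => ?_, fun t c => ?_⟩
  · rw [map_intCast, ← sub_eq_zero, ← Int.cast_sub, ZMod.intCast_zmod_eq_zero_iff_dvd]
    exact hcancel s _ ((hl s).dvd (hl t) (Nat.mul_dvd_mul_right hst _))
  · change (l (B.order i) : ZMod (B.order i : ℕ)) = _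
    obtain ⟨f, μ, -, -, hμ, hdvd⟩ := (hl (B.order i)).exists_cone hφ hgood i
    rw [← sub_eq_zero, ← Int.cast_sub, ZMod.intCast_zmod_eq_zero_iff_dvd]
    have := dvd_add (hcancel _ _ hdvd) hμ
    rwa [sub_add_sub_cancel] at this
  · refine H2map_eq_smul φ t (l t) (fun f hf => ?_) c
    refine IsDegree.comap_sub_mem_B2 hφ hgood (t := t) (fun a => ?_) (hl t) ⟨f, hf⟩
    funext j
    simp

end Degree

end OrbifoldSignature

/-! ### Positive genus, and realising all invariants from one central quotient -/

/-- The Heisenberg group over a commutative ring. -/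
@[ext]
structure HeisenbergGroup (R : Type*) where
  /-- The first coordinate. -/
  a : R
  /-- The second coordinate. -/
  b : R
  /-- The central coordinate. -/
  c : R

namespace HeisenbergGroup

variable {R : Type*} [CommRing R]

instance : Mul (HeisenbergGroup R) := ⟨fun p q => ⟨p.a + q.a, p.b + q.b, p.c + q.c + p.a * q.b⟩⟩

instance : One (HeisenbergGroup R) := ⟨⟨0, 0, 0⟩⟩

instance : Inv (HeisenbergGroup R) := ⟨fun p => ⟨-p.a, -p.b, -p.c + p.a * p.b⟩⟩

lemma mul_def (p q : HeisenbergGroup R) :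
    p * q = ⟨p.a + q.a, p.b + q.b, p.c + q.c + p.a * q.b⟩ := rfl

lemma one_def : (1 : HeisenbergGroup R) = ⟨0, 0, 0⟩ := rfl

lemma inv_def (p : HeisenbergGroup R) : p⁻¹ = ⟨-p.a, -p.b, -p.c + p.a * p.b⟩ := rfl

instance : Group (HeisenbergGroup R) := Group.ofLeftAxioms
  (fun p q s => by ext <;> simp only [mul_def] <;> ring)
  (fun p => by ext <;> simp [mul_def, one_def])
  (fun p => by ext <;> simp [mul_def, one_def, inv_def])

instance [Finite R] : Finite (HeisenbergGroup R) :=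
  .of_injective (fun p : HeisenbergGroup R => (p.a, p.b, p.c)) fun p q h => by
    simp only [Prod.mk.injEq] at h
    exact HeisenbergGroup.ext h.1 h.2.1 h.2.2

/-- The inclusion of the centre. -/
def center : Multiplicative R →* HeisenbergGroup R where
  toFun k := ⟨0, 0, k.toAdd⟩
  map_one' := rfl
  map_mul' k l := by simp [mul_def]

lemma commute_center (k : Multiplicative R) (p : HeisenbergGroup R) : Commute (center k) p := by
  ext <;> simp [center, mul_def, add_comm]

lemma center_injective : Function.Injective (center (R := R)) := fun k l h => by
  simpa [center] using h

lemma commutator_eq (w : R) : (⟨w, 0, 0⟩ * ⟨0, 1, 0⟩ * ⟨w, 0, 0⟩⁻¹ * ⟨0, 1, 0⟩⁻¹ :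
    HeisenbergGroup R) = center (.ofAdd w) := by
  ext <;> simp [center, mul_def, inv_def]

end HeisenbergGroup

/-- Multiplication by `c` embeds `ℤ/n` into `ℤ/(nc)`. -/
lemma ZMod.exists_injective_mul (n : ℕ) {c : ℕ} (hc : c ≠ 0) :
    ∃ θ : ZMod n →+ ZMod (n * c), Function.Injective θ ∧ ∀ k : ℤ, θ k = k * c := by
  let θ : ZMod n →+ ZMod (n * c) := ZMod.lift n ⟨zmultiplesHom _ (c : ZMod _),
    by simp [← Nat.cast_mul]⟩
  have hθ : ∀ k : ℤ, θ k = k * c := fun k => by simp [θ]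
  refine ⟨θ, (injective_iff_map_eq_zero θ).2 fun x hx => ?_, hθ⟩
  obtain ⟨x, rfl⟩ := ZMod.intCast_surjective x
  rw [hθ] at hx
  rw [ZMod.intCast_zmod_eq_zero_iff_dvd]
  have hx' : ((x * c : ℤ) : ZMod (n * c)) = 0 := by simpa using hx
  rw [ZMod.intCast_zmod_eq_zero_iff_dvd, Nat.cast_mul] at hx'
  exact Int.dvd_of_mul_dvd_mul_right (by exact_mod_cast hc) hx'

namespace OrbifoldSignature

variable {B : OrbifoldSignature}

/-- There is a finite group with a central cyclic subgroup of order `n` and elements satisfying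
the relations of the orbifold group, up to the long relator being a prescribed central element. -/
def HasCentralQuotient (B : OrbifoldSignature) (n : ℕ) (w : ZMod n) : Prop :=
  ∃ (F : Type) (_ : Group F) (_ : Finite F) (ι : Multiplicative (ZMod n) →* F) (X : B.Gen → F),
    Function.Injective ι ∧ (∀ a γ, Commute (ι a) (X γ)) ∧
    (∀ i, X (Gen.x i) ^ (B.order i : ℕ) = 1) ∧ FreeGroup.lift X B.longRelator = ι (.ofAdd w)

/-- A single Heisenberg commutator produces `w`; the cone generators and the remaining commutators
are trivial. -/
lemma hasCentralQuotient_of_genus_pos (hg : 0 < B.genus) (n : ℕ) [NeZero n] (w : ZMod n) :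
    B.HasCentralQuotient n w := by
  let j₀ : Fin B.genus := ⟨0, hg⟩
  let X : B.Gen → HeisenbergGroup (ZMod n) := fun γ =>
    match γ with
    | .x _ => 1
    | .u j => if j = j₀ then ⟨w, 0, 0⟩ else 1
    | .v _ => ⟨0, 1, 0⟩
  refine ⟨HeisenbergGroup (ZMod n), inferInstance, inferInstance, HeisenbergGroup.center, X,
    HeisenbergGroup.center_injective, fun a γ => HeisenbergGroup.commute_center _ _,
    fun i => one_pow _, ?_⟩
  have h : ∀ j, X (.u j) * X (.v j) * (X (.u j))⁻¹ * (X (.v j))⁻¹ =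
      HeisenbergGroup.center (if j = j₀ then .ofAdd w else 1) := fun j => by
    simp only [X]
    split_ifs
    · exact HeisenbergGroup.commutator_eq w
    · simp
  simp only [longRelator, map_mul, map_list_prod, List.map_ofFn, Function.comp_def, map_inv,
    FreeGroup.lift_apply_of, h]
  have h1 := map_list_prod (HeisenbergGroup.center (R := ZMod n))
    (List.ofFn fun j => if j = j₀ then Multiplicative.ofAdd w else 1)
  rw [List.map_ofFn, List.prod_ofFn] at h1
  simp only [Function.comp_def, Finset.prod_ite_eq', Finset.mem_univ, if_true] at h1
  rw [← h1]
  simp [X]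

/-- All invariants modulo `N` are realized. -/
lemma exists_hasInvariants (h : ∀ (n : ℕ) [NeZero n] (w : ZMod n), B.HasCentralQuotient n w)
    (N : ℕ) [NeZero N] (a : Fin B.numCone → ZMod N) (b : ZMod N) :
    ∃ f : Z2 B.ProfiniteGroup (ZMod N), HasInvariants f a b := by
  have : NeZero (N * B.orderProd) := ⟨mul_ne_zero (NeZero.ne N) orderProd_pos.ne'⟩
  choose a' ha' using fun i => ZMod.intCast_surjective (a i)
  obtain ⟨b', rfl⟩ := ZMod.intCast_surjective b
  choose e he using fun i => order_dvd_orderProd (B := B) i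
  -- Embedding `ℤ/N` in `ℤ/(N M)` by multiplication by `M` makes the image of `a i` divisible by
  -- `m_i`, with quotient `a' i * e i`. Multiplying `X_i` by that central element sets its power;
  -- the prescribed long relator compensates for the resulting sum.
  obtain ⟨F, _, _, ι, X, hι, hcomm, hX, hlong⟩ := h (N * B.orderProd)
    (B.orderProd * b' - ∑ i, a' i * e i)
  obtain ⟨θ, hθ, hθ1⟩ := ZMod.exists_injective_mul N orderProd_pos.ne'
  let E : B.Gen → Multiplicative (ZMod (N * B.orderProd)) := fun γ =>
    match γ with
    | .x i => .ofAdd (a' i * e i)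
    | .u _ => 1
    | .v _ => 1
  -- The image of `ι` commutes with the `X γ` but need not be central in `F`, so `F` is replaced by
  -- its centralizer.
  let F₁ := Subgroup.centralizer (Set.range ι)
  have hιF : ∀ k, ι k ∈ F₁ := fun k => by
    rintro _ ⟨l, rfl⟩
    rw [← map_mul, ← map_mul, mul_comm l k]
  have hXF : ∀ γ, X γ ∈ F₁ := fun γ => by
    rintro _ ⟨l, rfl⟩
    exact (hcomm l γ).eq
  let ι₁ : Multiplicative (ZMod (N * B.orderProd)) →* F₁ := ι.codRestrict F₁ hιF
  have hcomm₁ : ∀ k (x : F₁), Commute (ι₁ k) x := fun k x =>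
    Subtype.ext (x.2 _ ⟨k, rfl⟩)
  let X₁ : B.Gen → F₁ := fun γ => ⟨X γ, hXF γ⟩
  have hX₁ : ∀ w, (FreeGroup.lift X₁ w : F) = FreeGroup.lift X w := fun w => by
    have : F₁.subtype.comp (FreeGroup.lift X₁) = FreeGroup.lift X := by
      ext γ
      simp [X₁]
    exact congr($this w)
  have hlift : ∀ w, FreeGroup.lift (fun γ => X₁ γ * ι₁ (E γ)) w =
      FreeGroup.lift X₁ w * ι₁ (FreeGroup.lift E w) := by
    let R : FreeGroup B.Gen →* F₁ := MonoidHom.mk'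
      (fun w => FreeGroup.lift X₁ w * ι₁ (FreeGroup.lift E w)) fun v w => by
        simp only [map_mul, mul_assoc]
        rw [← mul_assoc (ι₁ _) (FreeGroup.lift X₁ w), (hcomm₁ _ (FreeGroup.lift X₁ w)).eq,
          mul_assoc]
    have : FreeGroup.lift (fun γ => X₁ γ * ι₁ (E γ)) = R := by
      ext γ
      simp [R]
    exact fun w => congr($this w)
  refine exists_hasInvariants_of_finite (ι₁.comp (AddMonoidHom.toMultiplicative θ)) ?_
    (fun k x => hcomm₁ _ x) (fun γ => X₁ γ * ι₁ (E γ)) a b' (fun i => ?_) ?_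
  · intro k l hkl
    exact hθ (hι (congr_arg Subtype.val hkl))
  · have h1 : X₁ (Gen.x i) ^ (B.order i : ℕ) = 1 := Subtype.ext (hX i)
    rw [(hcomm₁ _ _).symm.mul_pow, h1, one_mul, ← map_pow, ← ha']
    change ι₁ _ = ι₁ (.ofAdd (θ (a' i)))
    have h2 := congr_arg (Nat.cast : ℕ → ZMod (N * B.orderProd)) (he i)
    rw [hθ1, h2]
    congr 1
    simp only [E, ← ofAdd_nsmul]
    congr 1
    rw [nsmul_eq_mul]
    push_cast
    ring
  · have h1 : FreeGroup.lift X₁ B.longRelator = ι₁ (.ofAdd (B.orderProd * b' - ∑ i, a' i * e i)) :=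
      Subtype.ext ((hX₁ _).trans hlong)
    rw [hlift, h1, ← map_mul, map_longRelator]
    change ι₁ _ = ι₁ (.ofAdd (θ b'))
    rw [hθ1]
    congr 1
    simp only [FreeGroup.lift_apply_of, E, ← ofAdd_sum, ← ofAdd_add]
    congr 1
    push_cast
    rw [sub_add_cancel]
    exact mul_comm _ _

end OrbifoldSignature

/-! ### Elements of prescribed orders with product one in `SL₂` modulo its centre -/

lemma List.prod_ofFn_cons {M : Type*} [Monoid M] {n : ℕ} (x : M) (f : Fin n → M) :
    (List.ofFn (Fin.cons x f : Fin (n + 1) → M)).prod = x * (List.ofFn f).prod := by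
  rw [List.ofFn_succ, List.prod_cons]
  rfl

namespace Matrix.SpecialLinearGroup

variable {K : Type*} [Field K]

lemma coe_mul_self_fin_two (A : SpecialLinearGroup (Fin 2) K) :
    A.1 * A.1 = A.1.trace • A.1 - 1 := by
  have h := A.2
  rw [Matrix.det_fin_two] at h
  ext i j
  fin_cases i <;> fin_cases j <;>
    simp [Matrix.mul_apply, Matrix.trace_fin_two] <;>
    first | linear_combination -h | ring

/-- Iterated Cayley–Hamilton; it shows which powers are scalar without diagonalising `A`. -/
lemma smul_coe_pow (A : SpecialLinearGroup (Fin 2) K) {ζ : K} (hζ : ζ ≠ 0)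
    (hA : A.1.trace = ζ + ζ⁻¹) (k : ℕ) :
    (ζ - ζ⁻¹) • A.1 ^ (k + 1) = (ζ ^ (k + 1) - ζ⁻¹ ^ (k + 1)) • A.1 - (ζ ^ k - ζ⁻¹ ^ k) • 1 := by
  induction k with
  | zero => simp
  | succ k ih =>
    rw [pow_succ A.1, ← smul_mul_assoc, ih, sub_mul, smul_mul_assoc, smul_mul_assoc, one_mul,
      coe_mul_self_fin_two, hA]
    have h1 : (ζ ^ (k + 1) - ζ⁻¹ ^ (k + 1)) * (ζ + ζ⁻¹) - (ζ ^ k - ζ⁻¹ ^ k) =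
        ζ ^ (k + 1 + 1) - ζ⁻¹ ^ (k + 1 + 1) := by
      linear_combination (ζ ^ k - ζ⁻¹ ^ k) * mul_inv_cancel₀ hζ
    rw [← h1]
    module

/-- An element of `SL₂` whose eigenvalues are primitive `2m`-th roots of unity has order `m` in
`PSL₂`. -/
lemma orderOf_mk_of_trace (A : SpecialLinearGroup (Fin 2) K) {ζ : K} {m : ℕ}
    (hm : 2 ≤ m) (hζ : IsPrimitiveRoot ζ (2 * m))
    (hA : A.1.trace = ζ + ζ⁻¹) :
    orderOf (QuotientGroup.mk A : SpecialLinearGroup (Fin 2) K ⧸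
      Subgroup.center (SpecialLinearGroup (Fin 2) K)) = m := by
  have hζ0 : ζ ≠ 0 := hζ.ne_zero (by omega)
  have hsq : ζ ^ 2 ≠ 1 := hζ.pow_ne_one_of_pos_of_lt (by omega) (by omega)
  have hne : ζ - ζ⁻¹ ≠ 0 := fun h => hsq (by
    rw [sub_eq_zero] at h
    rw [sq]
    nth_rewrite 2 [h]
    exact mul_inv_cancel₀ hζ0)
  have hζm : ζ ^ m = -1 := by
    have h1 : ζ ^ m ≠ 1 := hζ.pow_ne_one_of_pos_of_lt (by omega) (by omega)
    have h2 : (ζ ^ m) ^ 2 = 1 := by rw [← pow_mul, mul_comm, hζ.pow_eq_one]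
    exact (mul_self_eq_one_iff.1 (by rwa [← sq])).resolve_left h1
  rw [orderOf_eq_iff (by omega)]
  refine ⟨?_, fun j hj hj0 h => ?_⟩
  · rw [← QuotientGroup.mk_pow, QuotientGroup.eq_one_iff, mem_center_iff]
    refine ⟨-1, by simp, ?_⟩
    obtain ⟨k, rfl⟩ : ∃ k, m = k + 1 := ⟨m - 1, by omega⟩
    have h1 := smul_coe_pow A hζ0 hA k
    have h2 : ζ ^ k = -ζ⁻¹ := by
      rw [pow_succ] at hζm
      field_simp
      exact hζm
    rw [inv_pow, inv_pow, hζm, h2, inv_neg, inv_neg, inv_inv, inv_one, sub_self, zero_smul] at h1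
    have h3 : A.1 ^ (k + 1) = -1 := smul_right_injective _ hne (by
      simp only
      rw [h1]
      module)
    rw [coe_pow, map_neg, map_one]
    exact h3.symm
  · rw [← QuotientGroup.mk_pow, QuotientGroup.eq_one_iff, mem_center_iff] at h
    obtain ⟨r, -, hr⟩ := h
    obtain ⟨k, rfl⟩ : ∃ k, j = k + 1 := ⟨j - 1, by omega⟩
    have h1 := smul_coe_pow A hζ0 hA k
    rw [← coe_pow, ← hr] at h1
    -- Either the coefficient of `A` vanishes, so `ζ` has too small an order, or `A` itself is
    -- scalar, which forces `ζ` to be its double eigenvalue and `ζ ^ 2 = 1`.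
    by_cases hc : ζ ^ (k + 1) - ζ⁻¹ ^ (k + 1) = 0
    · have h2 : ζ ^ (2 * (k + 1)) = 1 := by
        rw [sub_eq_zero, inv_pow] at hc
        rw [two_mul, pow_add]
        nth_rewrite 2 [hc]
        exact mul_inv_cancel₀ (pow_ne_zero _ hζ0)
      exact hζ.pow_ne_one_of_pos_of_lt (by omega) (by omega) h2
    · rw [inv_pow] at hc
      have h01 := congr_fun₂ h1 0 1
      have h10 := congr_fun₂ h1 1 0
      have h00 := congr_fun₂ h1 0 0
      have h11 := congr_fun₂ h1 1 1
      simp at h01 h10 h00 h11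
      have e01 : A.1 0 1 = 0 := h01.resolve_left hc
      have e11 : A.1 0 0 = A.1 1 1 := mul_left_cancel₀ hc (by linear_combination h11 - h00)
      have hd := A.2
      rw [Matrix.det_fin_two, e01, zero_mul, sub_zero, e11] at hd
      rw [Matrix.trace_fin_two, e11] at hA
      have h2 : (ζ - A.1 1 1) ^ 2 = 0 := by
        have : ζ * ζ⁻¹ = 1 := mul_inv_cancel₀ hζ0
        linear_combination hd - ζ * hA - this
      have h3 := pow_eq_zero_iff (two_ne_zero) |>.1 h2
      rw [sub_eq_zero] at h3
      exact hsq (by rw [h3, sq, hd])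

/-- The nonzero corner comes from one unipotent entry in the last factor, and diagonal factors only
rescale it. It is what makes the trace equation in `exists_trace_eq_prod_eq_one` solvable. -/
lemma exists_trace_eq_prod_ne_zero (n : ℕ) (ζ : Fin (n + 1) → K) (hζ : ∀ i, ζ i ≠ 0) :
    ∃ X : Fin (n + 1) → SpecialLinearGroup (Fin 2) K, (∀ i, (X i).1.trace = ζ i + (ζ i)⁻¹) ∧
      (List.ofFn X).prod.1 0 1 ≠ 0 := by
  induction n with
  | zero =>
    let D : SpecialLinearGroup (Fin 2) K := ⟨!![ζ 0, 1; 0, (ζ 0)⁻¹], by simp [Matrix.det_fin_two, hζ]⟩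
    refine ⟨fun _ => D, fun i => ?_, ?_⟩
    · rw [Subsingleton.elim (α := Fin 1) i 0]
      simp [D, Matrix.trace_fin_two]
    · have h : (List.ofFn fun _ : Fin (0 + 1) => D).prod = D := by simp
      rw [h]
      simp [D]
  | succ n ih =>
    obtain ⟨X, hX, hprod⟩ := ih (fun i => ζ i.succ) fun i => hζ _
    let D : SpecialLinearGroup (Fin 2) K := ⟨!![ζ 0, 0; 0, (ζ 0)⁻¹], by simp [Matrix.det_fin_two, hζ]⟩
    refine ⟨Fin.cons D X, fun i => ?_, ?_⟩
    · refine Fin.cases ?_ (fun i => ?_) i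
      · change D.1.trace = _
        simp [D, Matrix.trace_fin_two]
      · exact hX i
    · rw [List.prod_ofFn_cons]
      change (D.1 * (List.ofFn X).prod.1) 0 1 ≠ 0
      rw [Matrix.mul_apply, Fin.sum_univ_two]
      have h : D.1 0 0 * (List.ofFn X).prod.1 0 1 + D.1 0 1 * (List.ofFn X).prod.1 1 1 =
          ζ 0 * (List.ofFn X).prod.1 0 1 := by simp only [D]; simp
      rw [h]
      exact mul_ne_zero (hζ 0) hprod

lemma trace_coe_inv_fin_two (A : SpecialLinearGroup (Fin 2) K) : (A⁻¹).1.trace = A.1.trace := by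
  rw [coe_inv, Matrix.adjugate_fin_two]
  simp [Matrix.trace_fin_two, add_comm]

/-- There are elements of `SL₂` with product one and prescribed eigenvalues. -/
lemma exists_trace_eq_prod_eq_one (n : ℕ) (ζ : Fin (n + 3) → K) (hζ : ∀ i, ζ i ≠ 0) :
    ∃ X : Fin (n + 3) → SpecialLinearGroup (Fin 2) K, (∀ i, (X i).1.trace = ζ i + (ζ i)⁻¹) ∧
      (List.ofFn X).prod = 1 := by
  obtain ⟨X, hX, hprod⟩ := exists_trace_eq_prod_ne_zero n (fun i => ζ i.succ.succ) fun i => hζ _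
  set C := (List.ofFn X).prod
  -- The trace of `Y * C` is affine in the lower-left entry `s` with slope `C 0 1`, so it can be
  -- given any value.
  let s : K := (ζ 0 + (ζ 0)⁻¹ - ζ 1 * C.1 0 0 - (ζ 1)⁻¹ * C.1 1 1) / C.1 0 1
  let Y : SpecialLinearGroup (Fin 2) K := ⟨!![ζ 1, 0; s, (ζ 1)⁻¹], by simp [Matrix.det_fin_two, hζ]⟩
  have hYC : (Y * C).1.trace = ζ 0 + (ζ 0)⁻¹ := by
    rw [coe_mul, Matrix.trace_fin_two, Matrix.mul_apply, Matrix.mul_apply, Fin.sum_univ_two,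
      Fin.sum_univ_two]
    simp [Y, s]
    field_simp
    ring
  refine ⟨Fin.cons (Y * C)⁻¹ (Fin.cons Y X), fun i => ?_, ?_⟩
  · refine Fin.cases ?_ (fun i => Fin.cases ?_ (fun i => ?_) i) i
    · rw [Fin.cons_zero, trace_coe_inv_fin_two, hYC]
    · change Y.1.trace = ζ 1 + (ζ 1)⁻¹
      simp [Y, Matrix.trace_fin_two]
    · exact hX i
  · rw [List.prod_ofFn_cons, List.prod_ofFn_cons]
    exact inv_mul_cancel (Y * C)

end Matrix.SpecialLinearGroup

/-- A finite group generated with product one by elements of prescribed orders. -/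
lemma exists_finite_group_orderOf_eq {r : ℕ} (hr : 3 ≤ r) (m : Fin r → ℕ) (hm : ∀ i, 2 ≤ m i) :
    ∃ (P : Type) (_ : Group P) (_ : Finite P) (g : Fin r → P),
      (List.ofFn g).prod = 1 ∧ ∀ i, orderOf (g i) = m i := by
  obtain ⟨n, rfl⟩ := Nat.exists_eq_add_of_le' hr
  have hM : ∏ i, 2 * m i ≠ 0 := Finset.prod_ne_zero_iff.2 fun i _ => by have := hm i; omega
  -- A prime `p ≡ 1` modulo all `2 m_i`, so that `𝔽_p` contains primitive `2 m_i`-th roots of unity.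
  obtain ⟨p, hp, -, hmod⟩ := Nat.exists_prime_gt_modEq_one 1 hM
  have : Fact p.Prime := ⟨hp⟩
  obtain ⟨u, hu⟩ := IsCyclic.exists_ofOrder_eq_natCard (α := (ZMod p)ˣ)
  rw [Nat.card_eq_fintype_card, ZMod.card_units] at hu
  have hprim : IsPrimitiveRoot (u : ZMod p) (p - 1) := by
    rw [← hu]
    exact IsPrimitiveRoot.coe_units_iff.2 (IsPrimitiveRoot.orderOf u)
  have hroot : ∀ i, ∃ ζ : ZMod p, IsPrimitiveRoot ζ (2 * m i) := fun i => by
    obtain ⟨e, he⟩ : 2 * m i ∣ p - 1 := (Finset.dvd_prod_of_mem (fun i => 2 * m i)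
      (Finset.mem_univ i)).trans ((Nat.modEq_iff_dvd' hp.one_le).1 hmod.symm)
    exact ⟨_, hprim.pow (Nat.sub_pos_of_lt hp.one_lt) (he.trans (mul_comm _ _))⟩
  choose ζ hζ using hroot
  obtain ⟨X, hX, hprod⟩ := Matrix.SpecialLinearGroup.exists_trace_eq_prod_eq_one n ζ
    fun i => (hζ i).ne_zero (by have := hm i; omega)
  refine ⟨_ ⧸ Subgroup.center (Matrix.SpecialLinearGroup (Fin 2) (ZMod p)), inferInstance,
    inferInstance, fun i => QuotientGroup.mk (X i), ?_,
    fun i => (X i).orderOf_mk_of_trace (hm i) (hζ i) (hX i)⟩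
  have := map_list_prod (QuotientGroup.mk' (Subgroup.center
    (Matrix.SpecialLinearGroup (Fin 2) (ZMod p)))) (List.ofFn X)
  rw [hprod, map_one, List.map_ofFn] at this
  exact this.symm

/-! ### Products of twisted permutations -/

section Permutations

open Equiv

/-- A map that intertwines permutations intertwines their products. -/
lemma Equiv.Perm.semiconj_prod_ofFn {α β : Type*} (F : α → β) {r : ℕ} (σ : Fin r → Perm α)
    (σ' : Fin r → Perm β) (h : ∀ i v, F (σ i v) = σ' i (F v)) (v : α) :
    F ((List.ofFn σ).prod v) = (List.ofFn σ').prod (F v) := by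
  induction r with
  | zero => simp
  | succ r ih =>
    rw [List.ofFn_succ, List.ofFn_succ, List.prod_cons, List.prod_cons, Perm.mul_apply,
      Perm.mul_apply, h, ih _ _ fun i => h i.succ]

/-- The product of the permutations after the `i`-th one. -/
def suffixProd {α : Type*} {r : ℕ} (σ : Fin r → Perm α) (i : Fin r) : Perm α :=
  (List.ofFn fun j => if i < j then σ j else 1).prod

lemma suffixProd_zero {α : Type*} {r : ℕ} (σ : Fin (r + 1) → Perm α) :
    suffixProd σ 0 = (List.ofFn fun j => σ j.succ).prod := by
  rw [suffixProd, List.ofFn_succ, List.prod_cons]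
  simp

lemma suffixProd_succ {α : Type*} {r : ℕ} (σ : Fin (r + 1) → Perm α) (i : Fin r) :
    suffixProd σ i.succ = suffixProd (fun j => σ j.succ) i := by
  rw [suffixProd, List.ofFn_succ, List.prod_cons]
  simp [suffixProd]

lemma apply_eq_self_of_suffixProd {α : Type*} {r : ℕ} (σ : Fin r → Perm α) (v : α)
    (h : ∀ i, σ i (suffixProd σ i v) = suffixProd σ i v) (i : Fin r) : σ i v = v := by
  induction r with
  | zero => exact i.elim0
  | succ r ih =>
    have h1 : ∀ i : Fin r, σ i.succ v = v := fun i =>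
      ih (fun i => σ i.succ) (fun i => by simpa only [suffixProd_succ] using h i.succ) i
    refine Fin.cases ?_ h1 i
    have h2 : suffixProd σ 0 v = v := by
      rw [suffixProd_zero]
      have := Perm.semiconj_prod_ofFn (fun _ : Unit => v) (fun _ : Fin r => 1)
        (fun j => σ j.succ) (fun i _ => (h1 i).symm) ()
      exact this.symm
    simpa [h2] using h 0

variable {S A : Type*} [AddCommGroup A]

/-- The permutation of `S × A` that is the conjugate of `σ` by the shift by `δ`. -/
def shiftConj (δ : S → A) : Perm S →* Perm (S × A) where
  toFun σ :=
    { toFun p := (σ p.1, p.2 + (δ (σ p.1) - δ p.1))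
      invFun p := (σ⁻¹ p.1, p.2 + (δ (σ⁻¹ p.1) - δ p.1))
      left_inv p := by simp [add_assoc]
      right_inv p := by simp [add_assoc] }
  map_one' := by ext p <;> simp
  map_mul' σ τ := by
    ext p
    · simp
    · simp only [Perm.mul_apply, coe_fn_mk]
      abel

lemma shiftConj_apply (δ : S → A) (σ : Perm S) (p : S × A) :
    shiftConj δ σ p = (σ p.1, p.2 + (δ (σ p.1) - δ p.1)) := rfl

/-- Each factor acts on the point already moved by the factors to its right. Because `δ i` depends
on `i`, the sum does not telescope, even when the `σ i` have product one. -/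
lemma prod_shiftConj {r : ℕ} (δ : Fin r → S → A) (σ : Fin r → Perm S) (p : S × A) :
    (List.ofFn fun i => shiftConj (δ i) (σ i)).prod p = ((List.ofFn σ).prod p.1,
      p.2 + ∑ i, (δ i (σ i (suffixProd σ i p.1)) - δ i (suffixProd σ i p.1))) := by
  induction r with
  | zero => simp
  | succ r ih =>
    rw [List.ofFn_succ, List.ofFn_succ, List.prod_cons, List.prod_cons, Perm.mul_apply,
      Perm.mul_apply, ih, shiftConj_apply, Fin.sum_univ_succ, suffixProd_zero]
    simp only [suffixProd_succ, Prod.mk.injEq, true_and]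
    abel

/-- Translations of the second factor. -/
def translateSnd (S A : Type*) [AddCommGroup A] : Multiplicative A →* Perm (S × A) where
  toFun a :=
    { toFun p := (p.1, p.2 + a.toAdd)
      invFun p := (p.1, p.2 - a.toAdd)
      left_inv p := by simp
      right_inv p := by simp }
  map_one' := by ext p <;> simp
  map_mul' a b := by ext p <;> simp [add_comm, add_left_comm]

lemma translateSnd_apply (a : Multiplicative A) (p : S × A) :
    translateSnd S A a p = (p.1, p.2 + a.toAdd) := rfl

lemma translateSnd_injective [Nonempty S] : Function.Injective (translateSnd S A) := fun a b h => by
  have := congr($h (Classical.arbitrary S, 0))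
  simpa [translateSnd_apply] using this

lemma commute_translateSnd (a : Multiplicative A) (δ : S → A) (σ : Perm S) :
    Commute (translateSnd S A a) (shiftConj δ σ) := by
  ext p <;> simp [translateSnd_apply, shiftConj_apply]
  abel

end Permutations

/-! ### Affine actions on functions on a finite group -/

section AffineAction

open Equiv

lemma isAffine_prod_ofFn {R V : Type*} [CommRing R] [AddCommGroup V] [Module R V] {r : ℕ}
    (σ : Fin r → Perm V)
    (h : ∀ i, ∃ (T : V →ₗ[R] V) (t : V), ∀ v, σ i v = T v + t) :
    ∃ (T : V →ₗ[R] V) (t : V), ∀ v, (List.ofFn σ).prod v = T v + t := by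
  induction r with
  | zero => exact ⟨.id, 0, fun v => by simp⟩
  | succ r ih =>
    obtain ⟨T, t, hT⟩ := ih (fun i => σ i.succ) fun i => h i.succ
    obtain ⟨T₀, t₀, hT₀⟩ := h 0
    refine ⟨T₀ ∘ₗ T, T₀ t + t₀, fun v => ?_⟩
    rw [List.ofFn_succ, List.prod_cons, Perm.mul_apply, hT, hT₀, map_add, add_assoc,
      LinearMap.comp_apply]

variable {P : Type} [Group P] {R : Type*} [CommRing R]

/-- The right translation action of `P` on functions, conjugated by the translation by `s`. -/
def affineAction (s : P → R) : P →* Perm (P → R) where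
  toFun g :=
    { toFun v p := s p + (v (p * g) - s (p * g))
      invFun v p := s p + (v (p * g⁻¹) - s (p * g⁻¹))
      left_inv v := by ext p; simp
      right_inv v := by ext p; simp }
  map_one' := by ext v p; simp
  map_mul' g h := by ext v p; simp [mul_assoc]

lemma affineAction_apply (s : P → R) (g : P) (v : P → R) (p : P) :
    affineAction s g v p = s p + (v (p * g) - s (p * g)) := rfl

lemma map_affineAction {R' : Type*} [CommRing R'] (f : R →+* R') (s : P → R) (g : P)
    (v : P → R) : f ∘ affineAction s g v = affineAction (f ∘ s) g (f ∘ v) := by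
  ext p
  simp [affineAction_apply]

/-- A product of affine transformations depends linearly on the centres. -/
lemma exists_prod_affineAction {r : ℕ} (g : Fin r → P) :
    ∃ D : (Fin r → P → R) →ₗ[R] (P → R), ∀ s v,
      (List.ofFn fun i => affineAction (s i) (g i)).prod v =
        affineAction 0 (List.ofFn g).prod v + D s := by
  induction r with
  | zero => exact ⟨0, fun s v => by simp⟩
  | succ r ih =>
    obtain ⟨D, hD⟩ := ih fun i => g i.succ
    let T : (P → R) →ₗ[R] (P → R) := LinearMap.funLeft R R (· * g 0)
    let π₀ : (Fin (r + 1) → P → R) →ₗ[R] (P → R) := LinearMap.proj 0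
    refine ⟨π₀ - T ∘ₗ π₀ + T ∘ₗ D ∘ₗ LinearMap.funLeft R (P → R) Fin.succ, fun s v => ?_⟩
    rw [List.ofFn_succ, List.ofFn_succ, List.prod_cons, List.prod_cons, Perm.mul_apply,
      hD fun i => s i.succ]
    ext p
    simp only [affineAction_apply, Pi.add_apply, LinearMap.add_apply, LinearMap.sub_apply,
      LinearMap.comp_apply, Pi.sub_apply, π₀, LinearMap.proj_apply, T, LinearMap.funLeft_apply,
      Pi.zero_apply, mul_assoc]
    change _ + (_ + (D fun i => s i.succ) _ - _) = _ + (_ - _ + (D fun i => s i.succ) _)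
    ring

lemma isAffine_affineAction (s : P → R) (g : P) :
    ∃ (T : (P → R) →ₗ[R] (P → R)) (t : P → R), ∀ v, affineAction s g v = T v + t :=
  ⟨LinearMap.funLeft R R (· * g), fun p => s p - s (p * g), fun v => by
    ext p
    simp only [affineAction_apply, Pi.add_apply, LinearMap.funLeft_apply]
    ring⟩

lemma isAffine_suffixProd {r : ℕ} (s : Fin r → P → R) (g : Fin r → P) (i : Fin r) :
    ∃ (T : (P → R) →ₗ[R] (P → R)) (t : P → R), ∀ v,
      suffixProd (fun i => affineAction (s i) (g i)) i v = T v + t := by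
  refine isAffine_prod_ofFn _ fun j => ?_
  split_ifs
  · exact isAffine_affineAction _ _
  · exact ⟨.id, 0, fun v => by simp⟩

/-- The functions fixed by right translation by `g`. -/
def fixedFunctions (K : Type*) [Field K] (g : P) : Submodule K (P → K) where
  carrier := {f | ∀ p, f (p * g) = f p}
  add_mem' hf hf' p := by simp only [Pi.add_apply, hf p, hf' p]
  zero_mem' _ := rfl
  smul_mem' c f hf p := by simp only [Pi.smul_apply, hf p]

/-- A fixed function is determined by its values on representatives of the cosets of `⟨g⟩`. -/
lemma orderOf_mul_finrank_fixedFunctions_le (K : Type*) [Field K] [Finite P] (g : P) :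
    orderOf g * Module.finrank K (fixedFunctions K g) ≤ Nat.card P := by
  classical
  have : Fintype (P ⧸ Subgroup.zpowers g) := Fintype.ofFinite _
  let E : fixedFunctions K g →ₗ[K] (P ⧸ Subgroup.zpowers g → K) :=
    LinearMap.funLeft K K Quotient.out ∘ₗ (fixedFunctions K g).subtype
  have hz : ∀ (f : fixedFunctions K g) (n : ℤ) (p : P), f.1 (p * g ^ n) = f.1 p := fun f n => by
    induction n with
    | zero => simp
    | succ n ih => intro p; rw [zpow_add_one, ← mul_assoc, f.2, ih]
    | pred n ih =>
      intro p
      rw [← f.2 (p * g ^ (-(n : ℤ) - 1)), mul_assoc, ← zpow_add_one, sub_add_cancel, ih]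
  have hE : Function.Injective E := by
    refine (injective_iff_map_eq_zero E).2 fun f hf => Subtype.ext (funext fun p => ?_)
    obtain ⟨h, hh⟩ := QuotientGroup.mk_out_eq_mul (Subgroup.zpowers g) p
    obtain ⟨n, hn⟩ := Subgroup.mem_zpowers_iff.1 h.2
    have h1 : f.1 (Quotient.out (QuotientGroup.mk p : P ⧸ Subgroup.zpowers g)) = 0 :=
      congr_fun hf (QuotientGroup.mk p)
    rw [hh, ← hn, hz] at h1
    exact h1
  have h1 := LinearMap.finrank_le_finrank_of_injective hE
  rw [Module.finrank_fintype_fun_eq_card, ← Nat.card_eq_fintype_card] at h1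
  rw [Subgroup.card_eq_card_quotient_mul_card_subgroup (Subgroup.zpowers g), Nat.card_zpowers,
    mul_comm]
  exact Nat.mul_le_mul_right _ h1

end AffineAction

/-! ### Linear algebra over `ℚ`, and the central extension in genus zero -/

/-- A common denominator of finitely many rational numbers. -/
lemma exists_common_denominator {ι : Type*} [Finite ι] (x : ι → ℚ) :
    ∃ (c : ℕ) (y : ι → ℤ), c ≠ 0 ∧ ∀ i, (y i : ℚ) = c * x i := by
  have := Fintype.ofFinite ι
  have h : ∀ i, ∃ y : ℤ, (y : ℚ) = (∏ j, (x j).den : ℕ) * x i := fun i => by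
    obtain ⟨e, he⟩ : (x i).den ∣ ∏ j, (x j).den :=
      Finset.dvd_prod_of_mem (fun j => (x j).den) (Finset.mem_univ i)
    refine ⟨e * (x i).num, ?_⟩
    rw [he]
    push_cast
    rw [mul_comm _ (e : ℚ), mul_assoc, mul_comm _ (x i), Rat.mul_den_eq_num]
  choose y hy using h
  exact ⟨_, y, Finset.prod_ne_zero_iff.2 fun i _ => (x i).den_nz, hy⟩

/-- Affine maps without a common zero admit functionals for which the sum of the compositions is
the constant one. -/
lemma exists_dual_sum_eq_one {K V W : Type*} [Field K] [AddCommGroup V] [Module K V]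
    [AddCommGroup W] [Module K W] {r : ℕ} (C : Fin r → V → W)
    (hC : ∀ i, ∃ (T : V →ₗ[K] W) (t : W), ∀ v, C i v = T v + t)
    (h0 : ¬ ∃ v, ∀ i, C i v = 0) :
    ∃ ψ : Fin r → W →ₗ[K] K, ∀ v, ∑ i, ψ i (C i v) = 1 := by
  classical
  choose T t hT using hC
  let L : V →ₗ[K] (Fin r → W) := LinearMap.pi T
  have ht : t ∉ LinearMap.range L := by
    rintro ⟨v, hv⟩
    refine h0 ⟨-v, fun i => ?_⟩
    rw [hT, ← hv, map_neg]
    simp [L]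
  obtain ⟨ψ, hψ, hψ0⟩ := Submodule.exists_le_ker_of_notMem ht
  refine ⟨fun i => (ψ t)⁻¹ • ψ ∘ₗ LinearMap.single K _ i, fun v => ?_⟩
  have h1 : ∀ x : Fin r → W, ∑ i, ψ (Pi.single i (x i)) = ψ x := fun x => by
    rw [← map_sum, Finset.univ_sum_single]
  have h2 : ψ (L v) = 0 := hψ0 ⟨v, rfl⟩
  calc _ = (ψ t)⁻¹ * ∑ i, ψ (Pi.single i (C i v)) := by simp [Finset.mul_sum]
    _ = (ψ t)⁻¹ * ψ (L v + t) := by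
      rw [h1 fun i => C i v]
      congr 2
      funext i
      simp [hT, L]
    _ = 1 := by rw [map_add, h2, zero_add, inv_mul_cancel₀ hψ]

section

variable {P : Type} [Group P]

/-- If the orders of `g i` are those of a hyperbolic signature then the relation `∏ g i = 1` lifts
to affine transformations without a common fixed point. -/
lemma exists_affineAction_prod_eq_one_rat [Finite P] {r : ℕ} (g : Fin r → P)
    (hg : (List.ofFn g).prod = 1) (h : 2 < ∑ i, (1 - 1 / (orderOf (g i) : ℚ))) :
    ∃ s : Fin r → P → ℚ, (∀ c : ℚ, (List.ofFn fun i => affineAction (c • s i) (g i)).prod = 1) ∧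
      ¬ ∃ w, ∀ i, affineAction (s i) (g i) w = w := by
  have := Fintype.ofFinite P
  obtain ⟨D, hD⟩ := exists_prod_affineAction (R := ℚ) g
  by_contra! hcon
  -- The range of `Φ` consists of the centres whose affine maps share a fixed point `w`: each `s i -
  -- w` must be fixed by `g i`.
  let Φ : ((P → ℚ) × ∀ i, fixedFunctions ℚ (g i)) →ₗ[ℚ] (Fin r → P → ℚ) :=
    LinearMap.pi fun i => LinearMap.fst ℚ _ _ +
      (fixedFunctions ℚ (g i)).subtype ∘ₗ LinearMap.proj i ∘ₗ LinearMap.snd ℚ _ _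
  have hle : LinearMap.ker D ≤ LinearMap.range Φ := fun s hs => by
    obtain ⟨w, hw⟩ := hcon s fun c => by
      ext1 v
      have h1 : D (c • s) = 0 := by rw [map_smul, LinearMap.mem_ker.1 hs, smul_zero]
      have := hD (c • s) v
      rw [h1, hg, map_one, add_zero] at this
      exact this
    refine ⟨(w, fun i => ⟨s i - w, fun p => ?_⟩), ?_⟩
    · have := congr_fun (hw i) p
      rw [affineAction_apply] at this
      simp only [Pi.sub_apply]
      linear_combination -this
    · ext i p
      simp [Φ]
  have h1 := Submodule.finrank_mono hle
  have h2 := LinearMap.finrank_range_add_finrank_ker D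
  have h3 := LinearMap.finrank_range_le Φ
  have h4 := Submodule.finrank_le (LinearMap.range D)
  simp only [Module.finrank_pi_fintype, Module.finrank_self, Finset.sum_const, Finset.card_univ,
    smul_eq_mul, mul_one, Fintype.card_fin, Module.finrank_prod] at h2 h3 h4
  set d := Fintype.card P with hd
  have hdpos : 0 < d := Fintype.card_pos
  have h5 : ∀ i, (Module.finrank ℚ (fixedFunctions ℚ (g i)) : ℚ) ≤ d * (1 / orderOf (g i)) :=
    fun i => by
      have := orderOf_mul_finrank_fixedFunctions_le ℚ (g i)
      rw [Nat.card_eq_fintype_card, ← hd] at this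
      have ho : (0 : ℚ) < orderOf (g i) := by exact_mod_cast orderOf_pos (g i)
      rw [mul_one_div, le_div_iff₀ ho, mul_comm]
      exact_mod_cast this
  -- The product relation costs at most `d` equations on `r d` unknowns. If all solutions had a
  -- common fixed point, the count would contradict hyperbolicity.
  have h6 : r * d ≤ d + (d + ∑ i, Module.finrank ℚ (fixedFunctions ℚ (g i))) := by omega
  have h7 : (r * d : ℚ) ≤ d + (d + ∑ i, (d * (1 / orderOf (g i)) : ℚ)) := by
    have : (r * d : ℚ) ≤ d + (d + ∑ i, (Module.finrank ℚ (fixedFunctions ℚ (g i)) : ℚ)) := by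
      exact_mod_cast h6
    exact this.trans (by gcongr with i; exact h5 i)
  rw [← Finset.mul_sum] at h7
  rw [Finset.sum_sub_distrib, Finset.sum_const, Finset.card_univ, Fintype.card_fin, nsmul_one] at h
  have hdq : (0 : ℚ) < d := by exact_mod_cast hdpos
  have := mul_lt_mul_of_pos_left h hdq
  linarith

/-- Scaling the centres preserves both properties, so denominators can be cleared; integrality
allows reduction modulo any integer. -/
lemma exists_affineAction_prod_eq_one_int [Finite P] {r : ℕ} (g : Fin r → P)
    (hg : (List.ofFn g).prod = 1) (h : 2 < ∑ i, (1 - 1 / (orderOf (g i) : ℚ))) :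
    ∃ s : Fin r → P → ℤ, (List.ofFn fun i => affineAction (s i) (g i)).prod = 1 ∧
      ¬ ∃ w : P → ℚ, ∀ i, affineAction (Int.castRingHom ℚ ∘ s i) (g i) w = w := by
  obtain ⟨s, hs, hfix⟩ := exists_affineAction_prod_eq_one_rat g hg h
  obtain ⟨c, y, hc, hy⟩ := exists_common_denominator fun p : Fin r × P => s p.1 p.2
  have hy' : ∀ i, Int.castRingHom ℚ ∘ (fun p => y (i, p)) = (c : ℚ) • s i := fun i => by
    ext p
    simp [hy]
  refine ⟨fun i p => y (i, p), ?_, ?_⟩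
  · ext1 v
    have := Equiv.Perm.semiconj_prod_ofFn (fun v : P → ℤ => Int.castRingHom ℚ ∘ v)
      (fun i => affineAction (fun p => y (i, p)) (g i)) (fun i => affineAction ((c : ℚ) • s i) (g i))
      (fun i v => by rw [map_affineAction, hy']) v
    rw [hs] at this
    exact (Int.cast_injective (α := ℚ)).comp_left this
  · rintro ⟨w, hw⟩
    refine hfix ⟨(c : ℚ)⁻¹ • w, fun i => ?_⟩
    have h1 := hw i
    rw [hy'] at h1
    have hcq : (c : ℚ) ≠ 0 := by exact_mod_cast hc
    ext p
    have h2 := congr_fun h1 p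
    simp only [affineAction_apply, Pi.smul_apply, smul_eq_mul] at h2 ⊢
    field_simp
    linear_combination h2

/-- The integral form of the duality argument. -/
lemma exists_int_functional {r : ℕ} [Fintype P] (g : Fin r → P) (s : Fin r → P → ℤ)
    (h : ¬ ∃ w : P → ℚ, ∀ i, affineAction (Int.castRingHom ℚ ∘ s i) (g i) w = w) :
    ∃ (c : ℕ) (b : Fin r → P → ℤ), c ≠ 0 ∧ ∀ v : P → ℤ, ∑ i, ∑ p, b i p *
      (affineAction (s i) (g i) (suffixProd (fun i => affineAction (s i) (g i)) i v) p -
        suffixProd (fun i => affineAction (s i) (g i)) i v p) = c := by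
  classical
  let σ := fun i => affineAction (Int.castRingHom ℚ ∘ s i) (g i)
  -- The displacements at the successive stages of the product are affine in `v`; a common zero
  -- would be a common fixed point of all `σ i`, by `apply_eq_self_of_suffixProd`.
  obtain ⟨ψ, hψ⟩ := exists_dual_sum_eq_one (K := ℚ)
    (fun i v => σ i (suffixProd σ i v) - suffixProd σ i v) (fun i => by
      obtain ⟨T, t, hT⟩ := isAffine_suffixProd (fun i => Int.castRingHom ℚ ∘ s i) g i
      obtain ⟨T', t', hT'⟩ := isAffine_affineAction (Int.castRingHom ℚ ∘ s i) (g i)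
      refine ⟨T' ∘ₗ T - T, T' t + t' - t, fun v => ?_⟩
      change affineAction _ _ (suffixProd _ i v) - suffixProd _ i v = _
      rw [hT, hT', map_add, LinearMap.sub_apply, LinearMap.comp_apply]
      abel) (fun ⟨v, hv⟩ => h ⟨v, fun i => apply_eq_self_of_suffixProd σ v
        (fun i => sub_eq_zero.1 (hv i)) i⟩)
  obtain ⟨c, y, hc, hy⟩ := exists_common_denominator
    fun p : Fin r × P => ψ p.1 (Pi.single p.2 1)
  refine ⟨c, fun i p => y (i, p), hc, fun v => ?_⟩
  have hcast : ∀ i, Int.castRingHom ℚ ∘ suffixProd (fun i => affineAction (s i) (g i)) i v =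
      suffixProd σ i (Int.castRingHom ℚ ∘ v) := fun i =>
    Equiv.Perm.semiconj_prod_ofFn (fun v : P → ℤ => Int.castRingHom ℚ ∘ v) _ _ (fun j v => by
      split_ifs
      · exact map_affineAction _ _ _ _
      · rfl) v
  have hcast' : ∀ i, Int.castRingHom ℚ ∘ affineAction (s i) (g i)
      (suffixProd (fun i => affineAction (s i) (g i)) i v) =
      σ i (suffixProd σ i (Int.castRingHom ℚ ∘ v)) := fun i => by
    rw [map_affineAction, hcast]
  have hψ' : ∀ i (w : P → ℚ), (c : ℚ) * ψ i w = ∑ p, y (i, p) * w p := fun i w => by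
    have h1 : w = ∑ p, w p • Pi.single p (1 : ℚ) := by
      ext q
      simp [Finset.sum_apply, Pi.single_apply]
    conv_lhs => rw [h1]
    rw [map_sum, Finset.mul_sum]
    refine Finset.sum_congr rfl fun p _ => ?_
    rw [map_smul, hy, smul_eq_mul]
    ring
  have h2 := congr_arg ((c : ℚ) * ·) (hψ (Int.castRingHom ℚ ∘ v))
  simp only [Finset.mul_sum, hψ', mul_one] at h2
  have h3 : ∀ i p, (σ i (suffixProd σ i (Int.castRingHom ℚ ∘ v)) - suffixProd σ i
      (Int.castRingHom ℚ ∘ v)) p = ((affineAction (s i) (g i)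
        (suffixProd (fun i => affineAction (s i) (g i)) i v) p -
        suffixProd (fun i => affineAction (s i) (g i)) i v p : ℤ) : ℚ) := fun i p => by
    rw [← hcast, Pi.sub_apply, ← map_affineAction]
    simp
  simp only [h3] at h2
  exact_mod_cast h2

/-- The central extension of the relation `∏ g i = 1` by a cyclic group. -/
lemma exists_central_perm [Finite P] {r : ℕ} (g : Fin r → P)
    (hg : (List.ofFn g).prod = 1) (h : 2 < ∑ i, (1 - 1 / (orderOf (g i) : ℚ)))
    (n : ℕ) [NeZero n] (w : ZMod n) :
    ∃ (F : Type) (_ : Group F) (_ : Finite F) (ι : Multiplicative (ZMod n) →* F)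
      (X : Fin r → F), Function.Injective ι ∧ (∀ a i, Commute (ι a) (X i)) ∧
      (∀ i, X i ^ orderOf (g i) = 1) ∧ (List.ofFn X).prod = ι (.ofAdd w) := by
  have := Fintype.ofFinite P
  obtain ⟨s, hs, hfix⟩ := exists_affineAction_prod_eq_one_int g hg h
  obtain ⟨c, b, hc, hb⟩ := exists_int_functional g s hfix
  obtain ⟨w, rfl⟩ := ZMod.intCast_surjective w
  have : NeZero (n * c) := ⟨mul_ne_zero (NeZero.ne n) hc⟩
  obtain ⟨θ, hθ, hθ1⟩ := ZMod.exists_injective_mul n hc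
  let f : ℤ →+* ZMod (n * c) := Int.castRingHom _
  let S := P → ZMod (n * c)
  let σ : Fin r → Equiv.Perm S := fun i => affineAction (f ∘ s i) (g i)
  -- The functionals scaled by `w` have total displacement `w * c`, which is `θ w` in `ℤ/(n c)`;
  -- this is why the modulus is `n * c`.
  let δ : Fin r → S → ZMod (n * c) := fun i v => ∑ p, f (w * b i p) * v p
  have hδ : ∀ i (u : P → ℤ), δ i (f ∘ u) = f (w * ∑ p, b i p * u p) := fun i u => by
    simp only [δ, Function.comp_apply, ← map_mul, ← map_sum, Finset.mul_sum, mul_assoc]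
  have hlift : ∀ v : S, ∃ v' : P → ℤ, f ∘ v' = v := fun v => by
    choose v' hv' using fun p => ZMod.intCast_surjective (v p)
    exact ⟨v', funext hv'⟩
  refine ⟨Equiv.Perm (S × ZMod (n * c)), inferInstance, inferInstance,
    (translateSnd S (ZMod (n * c))).comp (AddMonoidHom.toMultiplicative θ),
    fun i => shiftConj (δ i) (σ i), fun k l hkl =>
      hθ (translateSnd_injective (S := S) (A := ZMod (n * c)) hkl),
    fun a i => commute_translateSnd _ _ _, fun i => ?_, ?_⟩
  · rw [← map_pow, ← map_pow, pow_orderOf_eq_one, map_one, map_one]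
  · ext1 q
    obtain ⟨v, hv⟩ := hlift q.1
    have h1 : (List.ofFn σ).prod q.1 = q.1 := by
      rw [← hv, ← Equiv.Perm.semiconj_prod_ofFn (fun v : P → ℤ => f ∘ v)
        (fun i => affineAction (s i) (g i)) σ (fun i v => map_affineAction _ _ _ _) v, hs]
      rfl
    have hcast : ∀ i, suffixProd σ i q.1 =
        f ∘ suffixProd (fun i => affineAction (s i) (g i)) i v := fun i => by
      rw [← hv]
      refine (Equiv.Perm.semiconj_prod_ofFn (fun v : P → ℤ => f ∘ v) _ _ (fun j v => ?_) v).symm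
      split_ifs
      · exact map_affineAction _ _ _ _
      · rfl
    have h2 : ∀ i, δ i (σ i (suffixProd σ i q.1)) - δ i (suffixProd σ i q.1) =
        f (w * ∑ p, b i p * (affineAction (s i) (g i)
          (suffixProd (fun i => affineAction (s i) (g i)) i v) p -
        suffixProd (fun i => affineAction (s i) (g i)) i v p)) := fun i => by
      rw [hcast]
      change δ i (affineAction (f ∘ s i) (g i) _) - _ = _
      rw [← map_affineAction, hδ, hδ, ← map_sub, ← mul_sub, ← Finset.sum_sub_distrib]
      simp only [mul_sub]
    rw [prod_shiftConj, h1]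
    simp only [h2]
    rw [← map_sum, ← Finset.mul_sum, hb]
    change _ = (q.1, q.2 + θ w)
    rw [hθ1]
    simp [f]

end

/-! ### Genus zero and the conclusion -/

namespace OrbifoldSignature

variable {B : OrbifoldSignature}

/-- Hyperbolicity enters twice: it forces at least three cone points, as needed for the matrices,
and it is the inequality behind the dimension count. -/
lemma hasCentralQuotient_of_genus_eq_zero (hB : B.IsHyperbolic) (hg : B.genus = 0) (n : ℕ)
    [NeZero n] (w : ZMod n) : B.HasCentralQuotient n w := by
  have hsum : 2 < ∑ i, (1 - 1 / ((B.order i : ℕ) : ℚ)) := by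
    have := hB
    rw [IsHyperbolic, eulerChar, hg] at this
    simpa using this
  have hr : 3 ≤ B.numCone := by
    have h1 : ∑ i, (1 - 1 / ((B.order i : ℕ) : ℚ)) ≤ ∑ i : Fin B.numCone, 1 :=
      Finset.sum_le_sum fun i _ => by
        have : (0 : ℚ) ≤ 1 / ((B.order i : ℕ) : ℚ) := by positivity
        linarith
    have h2 : (2 : ℚ) < B.numCone := by simpa using hsum.trans_le h1
    exact_mod_cast h2
  obtain ⟨P, _, _, g, hprod, horder⟩ :=
    exists_finite_group_orderOf_eq hr (fun i => (B.order i : ℕ)) B.two_le_order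
  obtain ⟨F, hF, hfin, ι, X, hι, hcomm, hX, hlong⟩ := exists_central_perm g hprod
    (by simpa only [horder] using hsum) n w
  have : IsEmpty (Fin B.genus) := by rw [hg]; infer_instance
  let X' : B.Gen → F := fun γ =>
    match γ with
    | .x i => X i
    | .u _ => 1
    | .v _ => 1
  refine ⟨F, hF, hfin, ι, X', hι, fun a γ => ?_, fun i => by rw [← horder i]; exact hX i, ?_⟩
  · cases γ with
    | x i => exact hcomm a i
    | u j => exact isEmptyElim j
    | v j => exact isEmptyElim j
  · have h1 : ∀ x ∈ List.ofFn fun j => X' (.u j) * X' (.v j) * (X' (.u j))⁻¹ * (X' (.v j))⁻¹,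
        x = 1 := fun x hx => by
      obtain ⟨j, -⟩ := List.mem_ofFn.1 hx
      exact isEmptyElim j
    simp only [longRelator, map_mul, map_list_prod, List.map_ofFn, Function.comp_def, map_inv,
      FreeGroup.lift_apply_of]
    rw [List.prod_eq_one h1, mul_one]
    exact hlong

end OrbifoldSignature

theorem mainTheorem4 (B : OrbifoldSignature) (hB : B.IsHyperbolic)
    (φ : B.ProfiniteGroup ≃ₜ* B.ProfiniteGroup) (k : Fin B.numCone → ℤ)
    (hφ : ∀ i, IsConj (B.coneGen i ^ k i) (φ (B.coneGen i))) :
    ∃ κ : ProfiniteInt,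
      (∀ i, ProfiniteInt.toZMod (B.order i) κ = (k i : ZMod (B.order i : ℕ))) ∧
      ∀ (t : ℕ+) (c : H2 B.ProfiniteGroup t),
        H2map (φ : B.ProfiniteGroup →ₜ* B.ProfiniteGroup) t c =
          ProfiniteInt.toZMod t κ • c := by
  refine OrbifoldSignature.exists_profiniteInt
    (φ := (φ : B.ProfiniteGroup →ₜ* B.ProfiniteGroup)) hφ
    fun N _ a b => OrbifoldSignature.exists_hasInvariants (fun n _ w => ?_) N a b
  rcases Nat.eq_zero_or_pos B.genus with hg | hg
  · exact OrbifoldSignature.hasCentralQuotient_of_genus_eq_zero hB hg n w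
  · exact OrbifoldSignature.hasCentralQuotient_of_genus_pos hg n w
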